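/- **Definitions.** A reflexive $3$-globular set $A$ consists of sets $A(0),\dots,A(3)$ with maps $s,t:A(k+1)\to A(k)$ and $i:A(k)\to A(k+1)$ satisfying $ss=st$, $ts=tt$, $si=ti=1$. A ($3$-dimensional) magma is such an $A$ together with composites $\beta\circ_k\alpha\in A(m)$ for all $k<m$ and all $\alpha,\beta\in A(m)$ with $t^{m-k}\alpha=s^{m-k}\beta$, with $s(\beta\circ_k\alpha)=s\alpha$ and $t(\beta\circ_k\alpha)=t\beta$ if $k=m-1$, and $s(\beta\circ_k\alpha)=s\beta\circ_k s\alpha$ and $t(\beta\circ_k\alpha)=t\beta\circ_k t\alpha$ if $k<m-1$; a strict $3$-category has an underlying magma. Two $k$-cells are parallel if $k=0$ or they have the same source and the same target. A contraction on a map $f:A\to B$ of reflexive $3$-globular sets gives, for all parallel $k$-cells $x,y$ of $A$ with $fx=fy$: if $k<3$, a $(k+1)$-cell $[x,y]:x\to y$ with $f[x,y]=i(fx)$ and $[x,x]=ix$; if $k=3$, the equality $x=y$. Let $\mathcal Q$ be the category whose objects are maps of magmas $f:M\to B$, with $B$ a strict $3$-category, equipped with a contraction on $f$, and whose morphisms are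 commuting squares of a map of magmas and a map of strict $3$-categories that preserve contraction cells. The functor $U$ from $\mathcal Q$ to reflexive $3$-globular sets, sending such an object to the underlying reflexive globular set of $M$, has a left adjoint $F$; let $P=UF$ be the induced monad, with unit $\eta$. Write $FA=(\varphi:PA\to T_RA)$. A Penon $3$-category is a $P$-algebra $\theta:PA\to A$. Composition in $A$ is defined by $y\circ_k x:=\theta(\eta y\circ_k\eta x)$. **Theorem.** Let $\theta:PA\to A$ be a Penon $3$-category such that $A$ has exactly one $0$-cell $*$ and exactly one $1$-cell. Then: 1. $T_RA$, with the map $\varphi\eta:A\to T_RA$, is the free strict $3$-category on the reflexive globular set $A$. 2. For all $\alpha,\beta\in A(2)$ one has $\varphi(\eta\alpha\circ_1\eta\beta)=\varphi(\eta\beta\circ_1\eta\alpha)$ in $T_RA$, so that there is a contraction cell $[\eta\alpha\circ_1\eta\beta,\ \eta\beta\circ_1\eta\alpha]$ in $PA$. 3. For every contraction $3$-cell $[x,y]$ of $PA$ one has $[x,y]\circ_2[y,x]=i(y)$. 4. There is a symmetric monoidal category (in particular, all axioms of a braided monoidal category hold, and $\gamma_{\beta,\alpha}\gamma_{\alpha,\beta}=1$)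 in which the objects are the elements of $A(2)$; the morphisms $\alpha\to\beta$ are the $3$-cells with source $\alpha$ and target $\beta$, with composition $\circ_2$ and identities $i(\alpha)$; the tensor product is $\alpha\otimes\beta=\alpha\circ_1\beta$ on objects and $f\otimes g=f\circ_1 g$ on morphisms; the unit object is $i(i(*))$; the associators $(\alpha\otimes\beta)\otimes\gamma\to\alpha\otimes(\beta\otimes\gamma)$ and the unitors $i(i(*))\otimes\alpha\to\alpha$, $\alpha\otimes i(i(*))\to\alpha$ are the images under $\theta$ of the contraction cells $[(\eta\alpha\circ_1\eta\beta)\circ_1\eta\gamma,\ \eta\alpha\circ_1(\eta\beta\circ_1\eta\gamma)]$, $[\eta i(i(*))\circ_1\eta\alpha,\ \eta\alpha]$ and $[\eta\alpha\circ_1\eta i(i(*)),\ \eta\alpha]$; and the braiding is $\gamma_{\alpha,\beta}=\theta[\eta\alpha\circ_1\eta\beta,\ \eta\beta\circ_1\eta\alpha]:\alpha\otimes\beta\to\beta\otimes\alpha$. -/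

import Mathlib

open CategoryTheory

universe u

namespace Penon

/-! ### Reflexive globular sets -/

/-- An `n`-dimensional reflexive globular set: sets `cell k` of `k`-cells for `k ≤ n` (there are no
cells of dimension `> n`), with sources, targets and putative identities. -/
structure RGSet (n : ℕ) where
  cell : ℕ → Type u
  isEmpty_cell : ∀ k, n < k → IsEmpty (cell k)
  s : ∀ {k : ℕ}, cell (k + 1) → cell k
  t : ∀ {k : ℕ}, cell (k + 1) → cell k
  i : ∀ {k : ℕ}, k < n → cell k → cell (k + 1)
  s_s : ∀ {k : ℕ} (x : cell (k + 2)), s (s x) = s (t x)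
  t_s : ∀ {k : ℕ} (x : cell (k + 2)), t (s x) = t (t x)
  s_i : ∀ {k : ℕ} (h : k < n) (x : cell k), s (i h x) = x
  t_i : ∀ {k : ℕ} (h : k < n) (x : cell k), t (i h x) = x

namespace RGSet

variable {n : ℕ} (A : RGSet.{u} n)

theorem dim_le {k : ℕ} (x : A.cell k) : k ≤ n :=
  not_lt.1 fun h => (A.isEmpty_cell k h).false x

/-- The iterated source `s^{m-k}`. -/
def sTo {k m : ℕ} (h : k ≤ m) : A.cell m → A.cell k :=
  Nat.leRec (motive := fun j _ => A.cell j → A.cell k) id (fun _ _ ih x => ih (A.s x)) h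

/-- The iterated target `t^{m-k}`. -/
def tTo {k m : ℕ} (h : k ≤ m) : A.cell m → A.cell k :=
  Nat.leRec (motive := fun j _ => A.cell j → A.cell k) id (fun _ _ ih x => ih (A.t x)) h

/-- The iterated putative identity `i^{m-k}`. -/
def iTo {k m : ℕ} (h : k ≤ m) (hm : m ≤ n) (x : A.cell k) : A.cell m :=
  Nat.leRec (motive := fun j _ => j ≤ n → A.cell j) (fun _ => x)
    (fun _ _ ih hj => A.i hj (ih (Nat.le_of_succ_le hj))) h hm

@[simp] theorem sTo_self {k : ℕ} (x : A.cell k) : A.sTo le_rfl x = x := by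
  simp [sTo]

@[simp] theorem tTo_self {k : ℕ} (x : A.cell k) : A.tTo le_rfl x = x := by
  simp [tTo]

@[simp] theorem iTo_self {k : ℕ} (hk : k ≤ n) (x : A.cell k) : A.iTo le_rfl hk x = x := by
  simp [iTo]

theorem sTo_succ {k m : ℕ} (h : k ≤ m) (h' : k ≤ m + 1) (x : A.cell (m + 1)) :
    A.sTo h' x = A.sTo h (A.s x) := by
  simp only [sTo]; rw [Nat.leRec_succ _ _ h]

theorem tTo_succ {k m : ℕ} (h : k ≤ m) (h' : k ≤ m + 1) (x : A.cell (m + 1)) :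
    A.tTo h' x = A.tTo h (A.t x) := by
  simp only [tTo]; rw [Nat.leRec_succ _ _ h]

theorem iTo_succ {k m : ℕ} (h : k ≤ m) (h' : k ≤ m + 1) (hm : m + 1 ≤ n) (x : A.cell k) :
    A.iTo h' hm x = A.i hm (A.iTo h (Nat.le_of_succ_le hm) x) := by
  simp only [iTo]; rw [Nat.leRec_succ _ _ h]

@[simp] theorem sTo_one {k : ℕ} (h : k ≤ k + 1) (x : A.cell (k + 1)) : A.sTo h x = A.s x := by
  rw [A.sTo_succ le_rfl, sTo_self]

@[simp] theorem tTo_one {k : ℕ} (h : k ≤ k + 1) (x : A.cell (k + 1)) : A.tTo h x = A.t x := by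
  rw [A.tTo_succ le_rfl, tTo_self]

theorem sTo_t {k m : ℕ} (h : k < m) (x : A.cell (m + 1)) :
    A.sTo h.le (A.t x) = A.sTo h.le (A.s x) := by
  obtain ⟨m, rfl⟩ : ∃ j, m = j + 1 := ⟨m - 1, by omega⟩
  have hk : k ≤ m := by omega
  rw [A.sTo_succ hk, A.sTo_succ hk, A.s_s]

theorem tTo_s {k m : ℕ} (h : k < m) (x : A.cell (m + 1)) :
    A.tTo h.le (A.s x) = A.tTo h.le (A.t x) := by
  obtain ⟨m, rfl⟩ : ∃ j, m = j + 1 := ⟨m - 1, by omega⟩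
  have hk : k ≤ m := by omega
  rw [A.tTo_succ hk, A.tTo_succ hk, A.t_s]

theorem sTo_sTo {j k m : ℕ} (h : j ≤ k) (h' : k ≤ m) (x : A.cell m) :
    A.sTo h (A.sTo h' x) = A.sTo (h.trans h') x := by
  induction m, h' using Nat.le_induction with
  | base => simp
  | succ m hm ih => rw [A.sTo_succ hm, ih, A.sTo_succ (h.trans hm)]

theorem tTo_tTo {j k m : ℕ} (h : j ≤ k) (h' : k ≤ m) (x : A.cell m) :
    A.tTo h (A.tTo h' x) = A.tTo (h.trans h') x := by
  induction m, h' using Nat.le_induction with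
  | base => simp
  | succ m hm ih => rw [A.tTo_succ hm, ih, A.tTo_succ (h.trans hm)]

theorem sTo_tTo {j k m : ℕ} (h : j < k) (h' : k ≤ m) (x : A.cell m) :
    A.sTo h.le (A.tTo h' x) = A.sTo (h.le.trans h') x := by
  induction m, h' using Nat.le_induction with
  | base => simp
  | succ m hm ih =>
    rw [A.tTo_succ hm, ih, A.sTo_succ (h.le.trans hm), A.sTo_t (h.trans_le hm)]

theorem tTo_sTo {j k m : ℕ} (h : j < k) (h' : k ≤ m) (x : A.cell m) :
    A.tTo h.le (A.sTo h' x) = A.tTo (h.le.trans h') x := by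
  induction m, h' using Nat.le_induction with
  | base => simp
  | succ m hm ih =>
    rw [A.sTo_succ hm, ih, A.tTo_succ (h.le.trans hm), A.tTo_s (h.trans_le hm)]

theorem sTo_iTo {k m : ℕ} (h : k ≤ m) (hm : m ≤ n) (x : A.cell k) :
    A.sTo h (A.iTo h hm x) = x := by
  induction m, h using Nat.le_induction with
  | base => simp
  | succ m h ih => rw [A.sTo_succ h, A.iTo_succ h, A.s_i, ih]

theorem tTo_iTo {k m : ℕ} (h : k ≤ m) (hm : m ≤ n) (x : A.cell k) :
    A.tTo h (A.iTo h hm x) = x := by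
  induction m, h using Nat.le_induction with
  | base => simp
  | succ m h ih => rw [A.tTo_succ h, A.iTo_succ h, A.t_i, ih]

/-- Two `m`-cells `x`, `y` can be composed to `y ∘ₖ x`. -/
abbrev Composable {k m : ℕ} (h : k < m) (y x : A.cell m) : Prop :=
  A.tTo h.le x = A.sTo h.le y

variable {A}

theorem Composable.s {k m : ℕ} {h : k < m + 1} {y x : A.cell (m + 1)}
    (hc : A.Composable h y x) (h' : k < m) : A.Composable h' (A.s y) (A.s x) := by
  unfold Composable at *
  rw [A.tTo_s h', ← A.tTo_succ h'.le h.le, hc, A.sTo_succ h'.le h.le]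

theorem Composable.t {k m : ℕ} {h : k < m + 1} {y x : A.cell (m + 1)}
    (hc : A.Composable h y x) (h' : k < m) : A.Composable h' (A.t y) (A.t x) := by
  unfold Composable at *
  rw [A.sTo_t h', ← A.tTo_succ h'.le h.le, hc, A.sTo_succ h'.le h.le]

theorem Composable.i {k m : ℕ} {h : k < m} {y x : A.cell m}
    (hc : A.Composable h y x) (hm : m < n) :
    A.Composable (h.trans (Nat.lt_succ_self m)) (A.i hm y) (A.i hm x) := by
  unfold Composable at *
  rw [A.tTo_succ h.le, A.sTo_succ h.le, A.t_i, A.s_i, hc]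

/-- Parallel cells: any two `0`-cells, and higher cells with equal sources and equal targets. -/
def Parallel : ∀ {k : ℕ}, A.cell k → A.cell k → Prop
  | 0, _, _ => True
  | _ + 1, x, y => A.s x = A.s y ∧ A.t x = A.t y

end RGSet

/-- A map of reflexive globular sets. -/
@[ext]
structure RGHom {n : ℕ} (A B : RGSet.{u} n) where
  app : ∀ {k : ℕ}, A.cell k → B.cell k
  map_s : ∀ {k : ℕ} (x : A.cell (k + 1)), app (A.s x) = B.s (app x)
  map_t : ∀ {k : ℕ} (x : A.cell (k + 1)), app (A.t x) = B.t (app x)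
  map_i : ∀ {k : ℕ} (h : k < n) (x : A.cell k), app (A.i h x) = B.i h (app x)

namespace RGHom

variable {n : ℕ} {A B C : RGSet.{u} n}

/-- The identity map. -/
def id (A : RGSet.{u} n) : RGHom A A where
  app x := x
  map_s _ := rfl
  map_t _ := rfl
  map_i _ _ := rfl

/-- Composition of maps, in diagrammatic order. -/
def comp (f : RGHom A B) (g : RGHom B C) : RGHom A C where
  app x := g.app (f.app x)
  map_s x := by rw [f.map_s, g.map_s]
  map_t x := by rw [f.map_t, g.map_t]
  map_i h x := by rw [f.map_i, g.map_i]

theorem map_sTo (f : RGHom A B) {k m : ℕ} (h : k ≤ m) (x : A.cell m) :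
    f.app (A.sTo h x) = B.sTo h (f.app x) := by
  induction m, h using Nat.le_induction with
  | base => simp
  | succ m h ih => rw [A.sTo_succ h, B.sTo_succ h, ih, f.map_s]

theorem map_tTo (f : RGHom A B) {k m : ℕ} (h : k ≤ m) (x : A.cell m) :
    f.app (A.tTo h x) = B.tTo h (f.app x) := by
  induction m, h using Nat.le_induction with
  | base => simp
  | succ m h ih => rw [A.tTo_succ h, B.tTo_succ h, ih, f.map_t]

theorem map_iTo (f : RGHom A B) {k m : ℕ} (h : k ≤ m) (hm : m ≤ n) (x : A.cell k) :
    f.app (A.iTo h hm x) = B.iTo h hm (f.app x) := by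
  induction m, h using Nat.le_induction with
  | base => simp
  | succ m h ih => rw [A.iTo_succ h, B.iTo_succ h, f.map_i, ih]

theorem composable (f : RGHom A B) {k m : ℕ} {h : k < m} {y x : A.cell m}
    (hc : A.Composable h y x) : B.Composable h (f.app y) (f.app x) := by
  unfold RGSet.Composable at *
  rw [← f.map_tTo, ← f.map_sTo, hc]

theorem parallel (f : RGHom A B) {k : ℕ} {x y : A.cell k} (h : RGSet.Parallel x y) :
    RGSet.Parallel (f.app x) (f.app y) := by
  cases k with
  | zero => trivial
  | succ k => exact ⟨by rw [← f.map_s, h.1, f.map_s], by rw [← f.map_t, h.2, f.map_t]⟩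

end RGHom

/-- The category of `n`-dimensional reflexive globular sets. -/
instance (n : ℕ) : Category (RGSet.{u} n) where
  Hom := RGHom
  id := RGHom.id
  comp := RGHom.comp

/-! ### Magmas -/

/-- An `n`-dimensional magma: a reflexive globular set with a binary composition `y ∘ₖ x` of
`m`-cells along `k`-cells for all `k < m`. -/
structure Magma (n : ℕ) extends RGSet.{u} n where
  comp : ∀ {m : ℕ} (k : ℕ) (h : k < m) (y x : cell m), toRGSet.Composable h y x → cell m
  s_comp_top : ∀ {k : ℕ} (h : k < k + 1) (y x : cell (k + 1)) (hc : toRGSet.Composable h y x),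
    s (comp k h y x hc) = s x
  t_comp_top : ∀ {k : ℕ} (h : k < k + 1) (y x : cell (k + 1)) (hc : toRGSet.Composable h y x),
    t (comp k h y x hc) = t y
  s_comp : ∀ {k m : ℕ} (h : k < m + 1) (h' : k < m) (y x : cell (m + 1))
    (hc : toRGSet.Composable h y x),
    s (comp k h y x hc) = comp k h' (s y) (s x) (hc.s h')
  t_comp : ∀ {k m : ℕ} (h : k < m + 1) (h' : k < m) (y x : cell (m + 1))
    (hc : toRGSet.Composable h y x),
    t (comp k h y x hc) = comp k h' (t y) (t x) (hc.t h')

namespace Magma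

variable {n : ℕ} (M : Magma.{u} n)

theorem comp_congr {k m : ℕ} (h : k < m) {y y' x x' : M.cell m} (hy : y = y') (hx : x = x')
    (hc : M.Composable h y x) :
    M.comp k h y x hc = M.comp k h y' x' (hy ▸ hx ▸ hc) := by
  subst hy hx; rfl

theorem sTo_comp {k m : ℕ} (h : k < m) (y x : M.cell m) (hc : M.Composable h y x) :
    M.sTo h.le (M.comp k h y x hc) = M.sTo h.le x := by
  induction m, h using Nat.le_induction with
  | base => simp [M.s_comp_top]
  | succ m h' ih =>
    have h'' : k < m := h'
    rw [M.sTo_succ h''.le, M.sTo_succ h''.le, M.s_comp _ h'', ih]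

theorem tTo_comp {k m : ℕ} (h : k < m) (y x : M.cell m) (hc : M.Composable h y x) :
    M.tTo h.le (M.comp k h y x hc) = M.tTo h.le y := by
  induction m, h using Nat.le_induction with
  | base => simp [M.t_comp_top]
  | succ m h' ih =>
    have h'' : k < m := h'
    rw [M.tTo_succ h''.le, M.tTo_succ h''.le, M.t_comp _ h'', ih]

theorem composable_sTo {j k m : ℕ} (hj : j < k) (hk : k ≤ m) {y x : M.cell m}
    (hc : M.Composable (hj.trans_le hk) y x) : M.Composable hj (M.sTo hk y) (M.sTo hk x) := by
  unfold RGSet.Composable at *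
  rw [M.tTo_sTo hj, M.sTo_sTo, hc]

theorem composable_tTo {j k m : ℕ} (hj : j < k) (hk : k ≤ m) {y x : M.cell m}
    (hc : M.Composable (hj.trans_le hk) y x) : M.Composable hj (M.tTo hk y) (M.tTo hk x) := by
  unfold RGSet.Composable at *
  rw [M.sTo_tTo hj, M.tTo_tTo, hc]

theorem sTo_comp_lt {j k m : ℕ} (hj : j < k) (hk : k ≤ m) (y x : M.cell m)
    (hc : M.Composable (hj.trans_le hk) y x) :
    M.sTo hk (M.comp j (hj.trans_le hk) y x hc) =
      M.comp j hj (M.sTo hk y) (M.sTo hk x) (M.composable_sTo hj hk hc) := by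
  induction m, hk using Nat.le_induction with
  | base => simp
  | succ m h' ih =>
    rw [M.sTo_succ h', M.s_comp _ (hj.trans_le h'), ih]
    exact M.comp_congr _ (M.sTo_succ h' _ _).symm (M.sTo_succ h' _ _).symm _

theorem tTo_comp_lt {j k m : ℕ} (hj : j < k) (hk : k ≤ m) (y x : M.cell m)
    (hc : M.Composable (hj.trans_le hk) y x) :
    M.tTo hk (M.comp j (hj.trans_le hk) y x hc) =
      M.comp j hj (M.tTo hk y) (M.tTo hk x) (M.composable_tTo hj hk hc) := by
  induction m, hk using Nat.le_induction with
  | base => simp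
  | succ m h' ih =>
    rw [M.tTo_succ h', M.t_comp _ (hj.trans_le h'), ih]
    exact M.comp_congr _ (M.tTo_succ h' _ _).symm (M.tTo_succ h' _ _).symm _

variable {M}

/-! Side conditions under which the composites in the axioms of a strict `n`-category exist. -/

theorem composable_comp_left {k m : ℕ} {h : k < m} {z y x : M.cell m}
    (hzy : M.Composable h z y) (hyx : M.Composable h y x) :
    M.Composable h (M.comp k h z y hzy) x := by
  unfold RGSet.Composable at *
  rw [M.sTo_comp, hyx]

theorem composable_comp_right {k m : ℕ} {h : k < m} {z y x : M.cell m}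
    (hzy : M.Composable h z y) (hyx : M.Composable h y x) :
    M.Composable h z (M.comp k h y x hyx) := by
  unfold RGSet.Composable at *
  rw [M.tTo_comp, hzy]

theorem composable_interchange {j k m : ℕ} (hj : j < k) {hk : k < m} {w z y x : M.cell m}
    (hwz : M.Composable hk w z) (hyx : M.Composable hk y x)
    (hzx : M.Composable (hj.trans hk) z x) : M.Composable (hj.trans hk) w y := by
  unfold RGSet.Composable at *
  rw [← M.tTo_sTo hj hk.le y, ← hyx, M.tTo_tTo, hzx, ← M.sTo_tTo hj hk.le z, hwz, M.sTo_sTo]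

theorem composable_interchange_left {j k m : ℕ} (hj : j < k) {hk : k < m} {w z y x : M.cell m}
    (hwz : M.Composable hk w z) (hyx : M.Composable hk y x)
    (hzx : M.Composable (hj.trans hk) z x) :
    M.Composable (hj.trans hk) (M.comp k hk w z hwz) (M.comp k hk y x hyx) := by
  have hwy := composable_interchange hj hwz hyx hzx
  unfold RGSet.Composable at *
  rw [← M.tTo_tTo hj.le hk.le, M.tTo_comp, M.tTo_tTo, hwy, ← M.sTo_tTo hj hk.le (M.comp _ _ _ _ _),
    M.tTo_comp, M.sTo_tTo hj]

theorem composable_interchange_right {j k m : ℕ} (hj : j < k) {hk : k < m} {w z y x : M.cell m}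
    (hwz : M.Composable hk w z) (hyx : M.Composable hk y x)
    (hzx : M.Composable (hj.trans hk) z x) :
    M.Composable hk (M.comp j (hj.trans hk) w y (composable_interchange hj hwz hyx hzx))
      (M.comp j (hj.trans hk) z x hzx) := by
  unfold RGSet.Composable
  rw [M.tTo_comp_lt hj, M.sTo_comp_lt hj]
  exact M.comp_congr _ hwz hyx _

theorem composable_iTo_right {k m : ℕ} (h : k < m) (x : M.cell m) :
    M.Composable h x (M.iTo h.le (M.dim_le x) (M.sTo h.le x)) := by
  unfold RGSet.Composable
  rw [M.tTo_iTo]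

theorem composable_iTo_left {k m : ℕ} (h : k < m) (x : M.cell m) :
    M.Composable h (M.iTo h.le (M.dim_le x) (M.tTo h.le x)) x := by
  unfold RGSet.Composable
  rw [M.sTo_iTo]

theorem composable_top {k : ℕ} {y x : M.cell (k + 1)} (h : M.t x = M.s y) :
    M.Composable (Nat.lt_succ_self k) y x := by
  simpa [RGSet.Composable] using h

end Magma

/-- A map of magmas: a map of reflexive globular sets that preserves composition. -/
@[ext]
structure MagmaHom {n : ℕ} (M N : Magma.{u} n) extends RGHom M.toRGSet N.toRGSet where
  map_comp : ∀ {k m : ℕ} (h : k < m) (y x : M.cell m) (hc : M.Composable h y x),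
    app (M.comp k h y x hc) = N.comp k h (app y) (app x) (toRGHom.composable hc)

namespace MagmaHom

variable {n : ℕ} {M N K : Magma.{u} n}

/-- The identity map. -/
def id (M : Magma.{u} n) : MagmaHom M M where
  toRGHom := RGHom.id M.toRGSet
  map_comp _ _ _ _ := rfl

/-- Composition of maps of magmas, in diagrammatic order. -/
def comp (f : MagmaHom M N) (g : MagmaHom N K) : MagmaHom M K where
  toRGHom := f.toRGHom.comp g.toRGHom
  map_comp h y x hc := by
    change g.app (f.app _) = _
    rw [f.map_comp, g.map_comp]
    rfl

end MagmaHom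

/-! ### Strict `n`-categories -/

/-- A strict `n`-category, as a magma in which composition is associative, the cells picked out by
`i` are units, and interchange holds (for composites and for identities). -/
structure StrictCat (n : ℕ) extends Magma.{u} n where
  assoc : ∀ {k m : ℕ} (h : k < m) (z y x : cell m) (hzy : toRGSet.Composable h z y)
    (hyx : toRGSet.Composable h y x),
    comp k h (comp k h z y hzy) x (toMagma.composable_comp_left hzy hyx) =
      comp k h z (comp k h y x hyx) (toMagma.composable_comp_right hzy hyx)
  comp_id : ∀ {k m : ℕ} (h : k < m) (x : cell m),
    comp k h x (toRGSet.iTo h.le (toRGSet.dim_le x) (toRGSet.sTo h.le x))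
      (toMagma.composable_iTo_right h x) = x
  id_comp : ∀ {k m : ℕ} (h : k < m) (x : cell m),
    comp k h (toRGSet.iTo h.le (toRGSet.dim_le x) (toRGSet.tTo h.le x)) x
      (toMagma.composable_iTo_left h x) = x
  interchange : ∀ {j k m : ℕ} (hj : j < k) (hk : k < m) (w z y x : cell m)
    (hwz : toRGSet.Composable hk w z) (hyx : toRGSet.Composable hk y x)
    (hzx : toRGSet.Composable (hj.trans hk) z x),
    comp j (hj.trans hk) (comp k hk w z hwz) (comp k hk y x hyx)
        (toMagma.composable_interchange_left hj hwz hyx hzx) =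
      comp k hk (comp j (hj.trans hk) w y (toMagma.composable_interchange hj hwz hyx hzx))
        (comp j (hj.trans hk) z x hzx) (toMagma.composable_interchange_right hj hwz hyx hzx)
  i_comp : ∀ {k m : ℕ} (h : k < m) (hm : m < n) (y x : cell m)
    (hc : toRGSet.Composable h y x),
    i hm (comp k h y x hc) = comp k (h.trans (Nat.lt_succ_self m)) (i hm y) (i hm x) (hc.i hm)

/-! ### Contractions -/

/-- A contraction on a map of `n`-dimensional reflexive globular sets. -/
@[ext]
structure Contraction {n : ℕ} {A B : RGSet.{u} n} (f : RGHom A B) where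
  cell : ∀ {k : ℕ}, k < n → ∀ x y : A.cell k, RGSet.Parallel x y → f.app x = f.app y →
    A.cell (k + 1)
  s_cell : ∀ {k : ℕ} (hk : k < n) (x y : A.cell k) (hp : RGSet.Parallel x y)
    (hf : f.app x = f.app y), A.s (cell hk x y hp hf) = x
  t_cell : ∀ {k : ℕ} (hk : k < n) (x y : A.cell k) (hp : RGSet.Parallel x y)
    (hf : f.app x = f.app y), A.t (cell hk x y hp hf) = y
  map_cell : ∀ {k : ℕ} (hk : k < n) (x y : A.cell k) (hp : RGSet.Parallel x y)
    (hf : f.app x = f.app y), f.app (cell hk x y hp hf) = B.i hk (f.app x)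
  cell_self : ∀ {k : ℕ} (hk : k < n) (x : A.cell k) (hp : RGSet.Parallel x x)
    (hf : f.app x = f.app x), cell hk x x hp hf = A.i hk x
  eq_of_top : ∀ x y : A.cell n, RGSet.Parallel x y → f.app x = f.app y → x = y

theorem Contraction.cell_congr {n : ℕ} {A B : RGSet.{u} n} {f : RGHom A B} (c : Contraction f)
    {k : ℕ} (hk : k < n) {x x' y y' : A.cell k} (hx : x = x') (hy : y = y')
    (hp : RGSet.Parallel x y) (hf : f.app x = f.app y) :
    c.cell hk x y hp hf = c.cell hk x' y' (hx ▸ hy ▸ hp) (hx ▸ hy ▸ hf) := by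
  subst hx hy; rfl

/-! ### The category `𝒬` and its forgetful functor -/

/-- An object of `𝒬`: a magma `top`, a strict `n`-category `base`, a map of magmas `φ` between
them and a contraction on it. -/
structure QObj (n : ℕ) where
  top : Magma.{u} n
  base : StrictCat.{u} n
  φ : MagmaHom top base.toMagma
  con : Contraction φ.toRGHom

/-- A morphism of `𝒬`: a commuting square of maps of magmas that preserves contraction cells. -/
@[ext]
structure QHom {n : ℕ} (X Y : QObj.{u} n) where
  top : MagmaHom X.top Y.top
  base : MagmaHom X.base.toMagma Y.base.toMagma
  comm : ∀ {k : ℕ} (x : X.top.cell k), Y.φ.app (top.app x) = base.app (X.φ.app x)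
  map_con : ∀ {k : ℕ} (hk : k < n) (x y : X.top.cell k) (hp : RGSet.Parallel x y)
    (hf : X.φ.app x = X.φ.app y),
    top.app (X.con.cell hk x y hp hf) =
      Y.con.cell hk (top.app x) (top.app y) (top.parallel hp) (by rw [comm, comm, hf])

namespace QHom

variable {n : ℕ} {X Y Z : QObj.{u} n}

/-- The identity morphism. -/
def id (X : QObj.{u} n) : QHom X X where
  top := MagmaHom.id X.top
  base := MagmaHom.id X.base.toMagma
  comm _ := rfl
  map_con _ _ _ _ _ := rfl

/-- Composition of morphisms, in diagrammatic order. -/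
def comp (f : QHom X Y) (g : QHom Y Z) : QHom X Z where
  top := f.top.comp g.top
  base := f.base.comp g.base
  comm x := by
    change Z.φ.app (g.top.app (f.top.app x)) = g.base.app (f.base.app _)
    rw [g.comm, f.comm]
  map_con hk x y hp hf := by
    change g.top.app (f.top.app _) = _
    rw [f.map_con, g.map_con]
    rfl

end QHom

/-- The category `𝒬`. -/
instance (n : ℕ) : Category (QObj.{u} n) where
  Hom := QHom
  id := QHom.id
  comp := QHom.comp

/-- The forgetful functor `U : 𝒬 ⥤ RGSet`. -/
def forgetQ (n : ℕ) : QObj.{u} n ⥤ RGSet.{u} n where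
  obj X := X.top.toRGSet
  map f := f.top.toRGHom

/-! ### The left adjoint of the forgetful functor

The free object of `𝒬` on `A` consists of the formal expressions in the cells of `A`, built with all
the operations of an object of `𝒬`, that are defined under every interpretation; two expressions
are identified if they agree under every interpretation. -/

namespace QObj

variable {n : ℕ}

/-- The two magmas of an object of `𝒬`: `true` for the top one, `false` for the base. -/
def car (X : QObj.{u} n) : Bool → Magma.{u} n
  | true => X.top
  | false => X.base.toMagma

end QObj

/-- Formal expressions of dimension `k`, in the top magma (`true`) or in the base (`false`). -/
inductive Expr {n : ℕ} (A : RGSet.{u} n) : Bool → ℕ → Type u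
  | gen {k : ℕ} (a : A.cell k) : Expr A true k
  | s {b : Bool} {k : ℕ} (x : Expr A b (k + 1)) : Expr A b k
  | t {b : Bool} {k : ℕ} (x : Expr A b (k + 1)) : Expr A b k
  | i {b : Bool} {k : ℕ} (x : Expr A b k) : Expr A b (k + 1)
  | comp {b : Bool} {m : ℕ} (k : ℕ) (y x : Expr A b m) : Expr A b m
  | phi {k : ℕ} (x : Expr A true k) : Expr A false k
  | con {k : ℕ} (x y : Expr A true k) : Expr A true (k + 1)

/-- `Ev X g e v`: the expression `e` is defined in `X` under the interpretation `g` of the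
generators, with value `v`. -/
inductive Ev {n : ℕ} {A : RGSet.{u} n} (X : QObj.{u} n) (g : RGHom A X.top.toRGSet) :
    ∀ {b : Bool} {k : ℕ}, Expr A b k → (X.car b).cell k → Prop
  | gen {k : ℕ} (a : A.cell k) : Ev X g (.gen a) (g.app a : X.top.cell k)
  | s {b : Bool} {k : ℕ} {x : Expr A b (k + 1)} {v : (X.car b).cell (k + 1)} (h : Ev X g x v) :
      Ev X g (.s x) ((X.car b).s v)
  | t {b : Bool} {k : ℕ} {x : Expr A b (k + 1)} {v : (X.car b).cell (k + 1)} (h : Ev X g x v) :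
      Ev X g (.t x) ((X.car b).t v)
  | i {b : Bool} {k : ℕ} {x : Expr A b k} {v : (X.car b).cell k} (hk : k < n) (h : Ev X g x v) :
      Ev X g (.i x) ((X.car b).i hk v)
  | comp {b : Bool} {k m : ℕ} {y x : Expr A b m} {w v : (X.car b).cell m} (hk : k < m)
      (hy : Ev X g y w) (hx : Ev X g x v) (hc : (X.car b).Composable hk w v) :
      Ev X g (.comp k y x) ((X.car b).comp k hk w v hc)
  | phi {k : ℕ} {x : Expr A true k} {v : X.top.cell k} (h : Ev X g x v) :
      Ev X g (.phi x) (X.φ.app v : X.base.cell k)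
  | con {k : ℕ} {x y : Expr A true k} {v w : X.top.cell k} (hk : k < n) (hx : Ev X g x v)
      (hy : Ev X g y w) (hp : RGSet.Parallel v w) (hf : X.φ.app v = X.φ.app w) :
      Ev X g (.con x y) (X.con.cell hk v w hp hf : X.top.cell (k + 1))

theorem Ev.unique {n : ℕ} {A : RGSet.{u} n} {X : QObj.{u} n} {g : RGHom A X.top.toRGSet}
    {b : Bool} {k : ℕ} {e : Expr A b k} {v w : (X.car b).cell k} (hv : Ev X g e v)
    (hw : Ev X g e w) : v = w := by
  induction hv with
  | gen a => cases hw; rfl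
  | s _ ih => cases hw with | s h => rw [ih h]
  | t _ ih => cases hw with | t h => rw [ih h]
  | i _ _ ih => cases hw with | i _ h => rw [ih h]
  | comp _ _ _ _ ihy ihx =>
    cases hw with
    | comp _ hy hx _ => obtain rfl := ihy hy; obtain rfl := ihx hx; rfl
  | phi _ ih => cases hw with | phi h => rw [ih h]
  | con _ _ _ _ _ ihx ihy =>
    cases hw with
    | con _ hx hy _ _ => obtain rfl := ihx hx; obtain rfl := ihy hy; rfl

section Free

variable {n : ℕ} (A : RGSet.{u} n)

/-- The expressions of dimension at most `n` that are defined under every interpretation. -/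
def DefExpr (b : Bool) (k : ℕ) : Type u :=
  { e : Expr A b k // k ≤ n ∧
    ∀ (X : QObj.{u} n) (g : RGHom A X.top.toRGSet), ∃ v, Ev X g e v }

/-- Expressions are identified if they agree under every interpretation. -/
def defExprSetoid (b : Bool) (k : ℕ) : Setoid (DefExpr A b k) where
  r e e' := ∀ (X : QObj.{u} n) (g : RGHom A X.top.toRGSet) (v : (X.car b).cell k),
    Ev X g e.1 v ↔ Ev X g e'.1 v
  iseqv := ⟨fun _ _ _ _ => Iff.rfl, fun h X g v => (h X g v).symm,
    fun h h' X g v => (h X g v).trans (h' X g v)⟩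

/-- The cells of the free object. -/
def FreeCell (b : Bool) (k : ℕ) : Type u := Quotient (defExprSetoid A b k)

variable {A}

/-- The class of an expression. -/
def FreeCell.mk {b : Bool} {k : ℕ} (e : Expr A b k) (hk : k ≤ n)
    (h : ∀ (X : QObj.{u} n) (g : RGHom A X.top.toRGSet), ∃ v, Ev X g e v) : FreeCell A b k :=
  Quotient.mk (defExprSetoid A b k) ⟨e, hk, h⟩

/-- An expression representing a cell of the free object. -/
noncomputable def FreeCell.rep {b : Bool} {k : ℕ} (q : FreeCell A b k) : DefExpr A b k :=
  @Quotient.out _ (defExprSetoid A b k) q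

/-- The value of a cell of the free object under an interpretation. -/
noncomputable def FreeCell.val {b : Bool} {k : ℕ} (X : QObj.{u} n) (g : RGHom A X.top.toRGSet)
    (q : FreeCell A b k) : (X.car b).cell k :=
  (q.rep.2.2 X g).choose

namespace FreeCell

variable {b : Bool} {k : ℕ}

theorem dim_le (q : FreeCell A b k) : k ≤ n := q.rep.2.1

theorem ev_rep (X : QObj.{u} n) (g : RGHom A X.top.toRGSet) (q : FreeCell A b k) :
    Ev X g q.rep.1 (q.val X g) :=
  (q.rep.2.2 X g).choose_spec

theorem mk_rep (q : FreeCell A b k) : mk q.rep.1 q.rep.2.1 q.rep.2.2 = q :=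
  @Quotient.out_eq _ (defExprSetoid A b k) q

theorem ext' {q q' : FreeCell A b k}
    (h : ∀ (X : QObj.{u} n) (g : RGHom A X.top.toRGSet), q.val X g = q'.val X g) : q = q' := by
  rw [← mk_rep q, ← mk_rep q']
  refine Quotient.sound (s := defExprSetoid A b k) fun X g v => ⟨fun hv => ?_, fun hv => ?_⟩
  · rw [hv.unique (q.ev_rep X g), h]; exact q'.ev_rep X g
  · rw [hv.unique (q'.ev_rep X g), ← h]; exact q.ev_rep X g

theorem val_mk {X : QObj.{u} n} {g : RGHom A X.top.toRGSet} {e : Expr A b k} {hk : k ≤ n}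
    {h : ∀ (X : QObj.{u} n) (g : RGHom A X.top.toRGSet), ∃ v, Ev X g e v}
    {v : (X.car b).cell k} (hv : Ev X g e v) : (mk e hk h).val X g = v := by
  have h1 := Quotient.exact (s := defExprSetoid A b k) (mk_rep (mk e hk h))
  exact ((h1 X g _).1 ((mk e hk h).ev_rep X g)).unique hv

end FreeCell

attribute [irreducible] FreeCell.mk FreeCell.val FreeCell.rep

open FreeCell

variable (A)

/-- The underlying reflexive globular sets of the free object. -/
noncomputable def freeRG (b : Bool) : RGSet.{u} n where
  cell k := FreeCell A b k
  isEmpty_cell k hk := ⟨fun q => absurd q.dim_le (not_le.2 hk)⟩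
  s q := mk (.s q.rep.1) (Nat.le_of_succ_le q.dim_le) fun X g => ⟨_, .s (q.ev_rep X g)⟩
  t q := mk (.t q.rep.1) (Nat.le_of_succ_le q.dim_le) fun X g => ⟨_, .t (q.ev_rep X g)⟩
  i hk q := mk (.i q.rep.1) hk fun X g => ⟨_, .i hk (q.ev_rep X g)⟩
  s_s q := ext' fun X g => by
    rw [val_mk (.s (ev_rep X g _)), val_mk (.s (ev_rep X g _)), val_mk (.s (ev_rep X g _)),
      val_mk (.t (ev_rep X g _)), RGSet.s_s]
  t_s q := ext' fun X g => by
    rw [val_mk (.t (ev_rep X g _)), val_mk (.s (ev_rep X g _)), val_mk (.t (ev_rep X g _)),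
      val_mk (.t (ev_rep X g _)), RGSet.t_s]
  s_i hk q := ext' fun X g => by
    rw [val_mk (.s (ev_rep X g _)), val_mk (.i hk (ev_rep X g _)), RGSet.s_i]
  t_i hk q := ext' fun X g => by
    rw [val_mk (.t (ev_rep X g _)), val_mk (.i hk (ev_rep X g _)), RGSet.t_i]

variable {A}

/-- Evaluation of the cells of the free object. -/
noncomputable def valRG (X : QObj.{u} n) (g : RGHom A X.top.toRGSet) (b : Bool) :
    RGHom (freeRG A b) (X.car b).toRGSet where
  app q := FreeCell.val X g q
  map_s q := val_mk (.s (ev_rep X g q))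
  map_t q := val_mk (.t (ev_rep X g q))
  map_i hk q := val_mk (.i hk (ev_rep X g q))

theorem freeRG_ext {b : Bool} {k : ℕ} {q q' : (freeRG A b).cell k}
    (h : ∀ (X : QObj.{u} n) (g : RGHom A X.top.toRGSet),
      (valRG X g b).app q = (valRG X g b).app q') : q = q' :=
  ext' h

/-- Composition in the free object. -/
noncomputable def freeComp {b : Bool} {m : ℕ} (k : ℕ) (h : k < m) (y x : (freeRG A b).cell m)
    (hc : (freeRG A b).Composable h y x) : (freeRG A b).cell m :=
  FreeCell.mk (.comp k (rep y).1 (rep x).1) ((freeRG A b).dim_le x) fun X g =>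
    ⟨_, .comp h (ev_rep X g y) (ev_rep X g x) ((valRG X g b).composable hc)⟩

theorem val_freeComp (X : QObj.{u} n) (g : RGHom A X.top.toRGSet) {b : Bool} {m : ℕ} (k : ℕ)
    (h : k < m) (y x : (freeRG A b).cell m) (hc : (freeRG A b).Composable h y x) :
    (valRG X g b).app (freeComp k h y x hc) =
      (X.car b).comp k h ((valRG X g b).app y) ((valRG X g b).app x)
        ((valRG X g b).composable hc) :=
  val_mk (.comp h (ev_rep X g y) (ev_rep X g x) ((valRG X g b).composable hc))

variable (A)

/-- The magmas of the free object. -/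
noncomputable def freeMagma (b : Bool) : Magma.{u} n where
  toRGSet := freeRG A b
  comp k h y x hc := freeComp k h y x hc
  s_comp_top h y x hc := freeRG_ext fun X g => by
    rw [RGHom.map_s, val_freeComp, RGHom.map_s, Magma.s_comp_top]
  t_comp_top h y x hc := freeRG_ext fun X g => by
    rw [RGHom.map_t, val_freeComp, RGHom.map_t, Magma.t_comp_top]
  s_comp h h' y x hc := freeRG_ext fun X g => by
    rw [RGHom.map_s, val_freeComp, val_freeComp, Magma.s_comp _ _ h']
    exact Magma.comp_congr _ _ (RGHom.map_s _ _).symm (RGHom.map_s _ _).symm _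
  t_comp h h' y x hc := freeRG_ext fun X g => by
    rw [RGHom.map_t, val_freeComp, val_freeComp, Magma.t_comp _ _ h']
    exact Magma.comp_congr _ _ (RGHom.map_t _ _).symm (RGHom.map_t _ _).symm _

variable {A}

/-- Evaluation as a map of magmas. -/
noncomputable def valMagma (X : QObj.{u} n) (g : RGHom A X.top.toRGSet) (b : Bool) :
    MagmaHom (freeMagma A b) (X.car b) where
  toRGHom := valRG X g b
  map_comp h y x hc := val_freeComp X g _ h y x hc

theorem freeMagma_ext {b : Bool} {k : ℕ} {q q' : (freeMagma A b).cell k}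
    (h : ∀ (X : QObj.{u} n) (g : RGHom A X.top.toRGSet),
      (valMagma X g b).app q = (valMagma X g b).app q') : q = q' :=
  ext' h

variable (A)

/-- The base of the free object. -/
noncomputable def freeBase : StrictCat.{u} n where
  toMagma := freeMagma A false
  assoc h z y x hzy hyx := freeMagma_ext fun X g => by
    simp only [MagmaHom.map_comp]
    exact X.base.assoc h _ _ _ _ _
  comp_id h x := freeMagma_ext fun X g => by
    simp only [MagmaHom.map_comp]
    refine Eq.trans ?_ (X.base.comp_id h _)
    refine Magma.comp_congr _ _ rfl ?_ _
    rw [RGHom.map_iTo, RGHom.map_sTo]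
    rfl
  id_comp h x := freeMagma_ext fun X g => by
    simp only [MagmaHom.map_comp]
    refine Eq.trans ?_ (X.base.id_comp h _)
    refine Magma.comp_congr _ _ ?_ rfl _
    rw [RGHom.map_iTo, RGHom.map_tTo]
    rfl
  interchange hj hk w z y x hwz hyx hzx := freeMagma_ext fun X g => by
    simp only [MagmaHom.map_comp]
    exact X.base.interchange hj hk _ _ _ _ _ _ _
  i_comp h hm y x hc := freeMagma_ext fun X g => by
    rw [RGHom.map_i, MagmaHom.map_comp, MagmaHom.map_comp]
    refine (X.base.i_comp h hm _ _ _).trans ?_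
    exact Magma.comp_congr _ _ (RGHom.map_i _ _ _).symm (RGHom.map_i _ _ _).symm _

/-- The map from the top magma of the free object to its base. -/
noncomputable def freePhi : MagmaHom (freeMagma A true) (freeMagma A false) where
  app q := FreeCell.mk (.phi (rep q).1) ((freeRG A true).dim_le q) fun X g =>
    ⟨_, .phi (ev_rep X g q)⟩
  map_s q := freeMagma_ext fun X g => by
    refine Eq.trans ?_ ((valMagma X g false).map_s _).symm
    refine (val_mk (.phi (ev_rep X g _))).trans ?_
    refine Eq.trans ?_ (congrArg (RGSet.s _) (val_mk (.phi (ev_rep X g _))).symm)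
    exact (congrArg X.φ.app ((valMagma X g true).map_s q)).trans (X.φ.map_s _)
  map_t q := freeMagma_ext fun X g => by
    refine Eq.trans ?_ ((valMagma X g false).map_t _).symm
    refine (val_mk (.phi (ev_rep X g _))).trans ?_
    refine Eq.trans ?_ (congrArg (RGSet.t _) (val_mk (.phi (ev_rep X g _))).symm)
    exact (congrArg X.φ.app ((valMagma X g true).map_t q)).trans (X.φ.map_t _)
  map_i hk q := freeMagma_ext fun X g => by
    refine Eq.trans ?_ ((valMagma X g false).map_i hk _).symm
    refine (val_mk (.phi (ev_rep X g _))).trans ?_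
    refine Eq.trans ?_ (congrArg (RGSet.i _ hk) (val_mk (.phi (ev_rep X g _))).symm)
    exact (congrArg X.φ.app ((valMagma X g true).map_i hk q)).trans (X.φ.map_i hk _)
  map_comp h y x hc := freeMagma_ext fun X g => by
    refine Eq.trans ?_ ((valMagma X g false).map_comp h _ _ _).symm
    refine (val_mk (.phi (ev_rep X g _))).trans ?_
    refine (congrArg X.φ.app ((valMagma X g true).map_comp h y x hc)).trans ?_
    refine (X.φ.map_comp h _ _ _).trans ?_
    exact Magma.comp_congr _ _ (val_mk (.phi (ev_rep X g _))).symm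
      (val_mk (.phi (ev_rep X g _))).symm _

variable {A}

theorem val_freePhi (X : QObj.{u} n) (g : RGHom A X.top.toRGSet) {k : ℕ}
    (q : (freeMagma A true).cell k) :
    (valMagma X g false).app ((freePhi A).app q) = X.φ.app ((valMagma X g true).app q) :=
  val_mk (.phi (ev_rep X g _))

theorem val_phi_eq (X : QObj.{u} n) (g : RGHom A X.top.toRGSet) {k : ℕ}
    {x y : (freeMagma A true).cell k} (h : (freePhi A).app x = (freePhi A).app y) :
    X.φ.app ((valMagma X g true).app x) = X.φ.app ((valMagma X g true).app y) := by
  rw [← val_freePhi, h, val_freePhi]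

/-- Contraction cells of the free object. -/
noncomputable def freeConCell {k : ℕ} (hk : k < n) (x y : (freeMagma A true).cell k)
    (hp : RGSet.Parallel x y) (hf : (freePhi A).app x = (freePhi A).app y) :
    (freeMagma A true).cell (k + 1) :=
  FreeCell.mk (.con (rep x).1 (rep y).1) hk fun X g =>
    ⟨_, .con hk (ev_rep X g x) (ev_rep X g y) ((valMagma X g true).parallel hp)
      (val_phi_eq X g hf)⟩

theorem val_freeConCell (X : QObj.{u} n) (g : RGHom A X.top.toRGSet) {k : ℕ} (hk : k < n)
    (x y : (freeMagma A true).cell k) (hp : RGSet.Parallel x y)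
    (hf : (freePhi A).app x = (freePhi A).app y) :
    (valMagma X g true).app (freeConCell hk x y hp hf) =
      X.con.cell hk ((valMagma X g true).app x) ((valMagma X g true).app y)
        ((valMagma X g true).parallel hp) (val_phi_eq X g hf) :=
  val_mk (.con hk (ev_rep X g x) (ev_rep X g y) ((valMagma X g true).parallel hp)
      (val_phi_eq X g hf))

variable (A)

/-- The free object of `𝒬` on a reflexive globular set. -/
noncomputable def freeQ : QObj.{u} n where
  top := freeMagma A true
  base := freeBase A
  φ := freePhi A
  con :=
    { cell := fun hk x y hp hf => freeConCell hk x y hp hf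
      s_cell := fun hk x y hp hf => freeMagma_ext fun X g => by
        exact ((valMagma X g true).map_s _).trans
          ((congrArg X.top.s (val_freeConCell X g hk x y hp hf)).trans (X.con.s_cell hk _ _ _ _))
      t_cell := fun hk x y hp hf => freeMagma_ext fun X g => by
        exact ((valMagma X g true).map_t _).trans
          ((congrArg X.top.t (val_freeConCell X g hk x y hp hf)).trans (X.con.t_cell hk _ _ _ _))
      map_cell := fun hk x y hp hf => freeMagma_ext fun X g => by
        refine (val_freePhi X g _).trans ?_
        refine (congrArg X.φ.app (val_freeConCell X g hk x y hp hf)).trans ?_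
        refine (X.con.map_cell hk _ _ _ _).trans ?_
        refine Eq.trans ?_ ((valMagma X g false).map_i hk _).symm
        exact congrArg (X.base.i hk) (val_freePhi X g x).symm
      cell_self := fun hk x hp hf => freeMagma_ext fun X g => by
        exact (val_freeConCell X g hk x x hp hf).trans
          ((X.con.cell_self hk _ _ _).trans ((valMagma X g true).map_i hk x).symm)
      eq_of_top := fun x y hp hf => freeMagma_ext fun X g =>
        X.con.eq_of_top _ _ ((valMagma X g true).parallel hp) (val_phi_eq X g hf) }

/-- The inclusion of generators. -/
def freeUnit : A ⟶ (forgetQ n).obj (freeQ A) where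
  app a := FreeCell.mk (.gen a) (A.dim_le a) fun X g => ⟨_, .gen a⟩
  map_s a := freeMagma_ext fun X g => by
    refine Eq.trans ?_ ((valMagma X g true).map_s _).symm
    refine (val_mk (.gen _)).trans ((g.map_s a).trans ?_)
    exact congrArg X.top.s (val_mk (.gen a)).symm
  map_t a := freeMagma_ext fun X g => by
    refine Eq.trans ?_ ((valMagma X g true).map_t _).symm
    refine (val_mk (.gen _)).trans ((g.map_t a).trans ?_)
    exact congrArg X.top.t (val_mk (.gen a)).symm
  map_i hk a := freeMagma_ext fun X g => by
    refine Eq.trans ?_ ((valMagma X g true).map_i hk _).symm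
    refine (val_mk (.gen _)).trans ((g.map_i hk a).trans ?_)
    exact congrArg (X.top.i hk) (val_mk (.gen a)).symm

variable {A}

/-- The morphism out of the free object induced by an interpretation of the generators. -/
noncomputable def freeLift (X : QObj.{u} n) (g : A ⟶ (forgetQ n).obj X) : freeQ A ⟶ X where
  top := valMagma X g true
  base := valMagma X g false
  comm q := (val_freePhi X g q).symm
  map_con hk x y hp hf := val_freeConCell X g hk x y hp hf

theorem freeUnit_lift (X : QObj.{u} n) (g : A ⟶ (forgetQ n).obj X) :
    freeUnit A ≫ (forgetQ n).map (freeLift X g) = g := by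
  apply RGHom.ext
  funext k a
  exact val_mk (.gen a)

/-- The components of a morphism of `𝒬` out of the free object. -/
def freeCar {X : QObj.{u} n} (f : QHom (freeQ A) X) :
    ∀ b : Bool, MagmaHom (freeMagma A b) (X.car b)
  | true => f.top
  | false => f.base

theorem freeCar_eq (X : QObj.{u} n) (f : freeQ A ⟶ X) (g : A ⟶ (forgetQ n).obj X)
    (hf : freeUnit A ≫ (forgetQ n).map f = g) {b : Bool} {k : ℕ} (e : Expr A b k) (hk : k ≤ n)
    (h : ∀ (X : QObj.{u} n) (g : RGHom A X.top.toRGSet), ∃ v, Ev X g e v) :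
    (freeCar f b).app (FreeCell.mk e hk h) = (valMagma X g b).app (FreeCell.mk e hk h) := by
  induction e with
  | gen a =>
    subst hf
    refine Eq.trans ?_ (val_mk (g := freeUnit A ≫ (forgetQ n).map f) (.gen a)).symm
    rfl
  | @s b k x ih =>
    have h' : ∀ (X : QObj.{u} n) (g : RGHom A X.top.toRGSet), ∃ v, Ev X g x v := fun X g => by
      obtain ⟨v, hv⟩ := h X g
      cases hv with | s hv => exact ⟨_, hv⟩
    have hk' : k + 1 ≤ n := (X.car b).dim_le (h' X g).choose
    have e : (FreeCell.mk (.s x) hk h : (freeMagma A b).cell k) =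
        (freeMagma A b).s (FreeCell.mk x hk' h') := freeMagma_ext fun X g => by
      obtain ⟨v, hv⟩ := h' X g
      refine (val_mk (.s hv)).trans (Eq.trans ?_ ((valMagma X g b).map_s _).symm)
      exact congrArg (X.car b).s (val_mk hv).symm
    rw [e]
    exact ((freeCar f b).map_s _).trans
      ((congrArg (X.car b).s (ih hk' h')).trans ((valMagma X g b).map_s _).symm)
  | @t b k x ih =>
    have h' : ∀ (X : QObj.{u} n) (g : RGHom A X.top.toRGSet), ∃ v, Ev X g x v := fun X g => by
      obtain ⟨v, hv⟩ := h X g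
      cases hv with | t hv => exact ⟨_, hv⟩
    have hk' : k + 1 ≤ n := (X.car b).dim_le (h' X g).choose
    have e : (FreeCell.mk (.t x) hk h : (freeMagma A b).cell k) =
        (freeMagma A b).t (FreeCell.mk x hk' h') := freeMagma_ext fun X g => by
      obtain ⟨v, hv⟩ := h' X g
      refine (val_mk (.t hv)).trans (Eq.trans ?_ ((valMagma X g b).map_t _).symm)
      exact congrArg (X.car b).t (val_mk hv).symm
    rw [e]
    exact ((freeCar f b).map_t _).trans
      ((congrArg (X.car b).t (ih hk' h')).trans ((valMagma X g b).map_t _).symm)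
  | @i b k x ih =>
    have h' : ∀ (X : QObj.{u} n) (g : RGHom A X.top.toRGSet), ∃ v, Ev X g x v := fun X g => by
      obtain ⟨v, hv⟩ := h X g
      cases hv with | i _ hv => exact ⟨_, hv⟩
    have e : (FreeCell.mk (.i x) hk h : (freeMagma A b).cell (k + 1)) =
        (freeMagma A b).i hk (FreeCell.mk x (Nat.le_of_succ_le hk) h') :=
      freeMagma_ext fun X g => by
        obtain ⟨v, hv⟩ := h' X g
        refine (val_mk (.i hk hv)).trans (Eq.trans ?_ ((valMagma X g b).map_i hk _).symm)
        exact congrArg ((X.car b).i hk) (val_mk hv).symm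
    rw [e]
    exact ((freeCar f b).map_i hk _).trans
      ((congrArg ((X.car b).i hk) (ih _ h')).trans ((valMagma X g b).map_i hk _).symm)
  | @comp b m k y x ihy ihx =>
    have hy : ∀ (X : QObj.{u} n) (g : RGHom A X.top.toRGSet), ∃ v, Ev X g y v := fun X g => by
      obtain ⟨v, hv⟩ := h X g
      cases hv with | comp _ hv _ _ => exact ⟨_, hv⟩
    have hx : ∀ (X : QObj.{u} n) (g : RGHom A X.top.toRGSet), ∃ v, Ev X g x v := fun X g => by
      obtain ⟨v, hv⟩ := h X g
      cases hv with | comp _ _ hv _ => exact ⟨_, hv⟩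
    have hkm : k < m := by
      obtain ⟨v, hv⟩ := h (freeQ A) (freeUnit A)
      cases hv with | comp h _ _ _ => exact h
    have hc : (freeMagma A b).Composable hkm (FreeCell.mk y hk hy) (FreeCell.mk x hk hx) :=
      freeMagma_ext fun X g => by
        obtain ⟨v, hv⟩ := h X g
        cases hv with
        | comp _ hy' hx' hc =>
          refine ((valMagma X g b).map_tTo _ _).trans
            (Eq.trans ?_ ((valMagma X g b).map_sTo _ _).symm)
          refine (congrArg ((X.car b).tTo hkm.le) (val_mk hx')).trans (hc.trans ?_)
          exact congrArg ((X.car b).sTo hkm.le) (val_mk hy').symm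
    have e : (FreeCell.mk (.comp k y x) hk h : (freeMagma A b).cell m) =
        (freeMagma A b).comp k hkm (FreeCell.mk y hk hy) (FreeCell.mk x hk hx) hc :=
      freeMagma_ext fun X g => by
        obtain ⟨v, hv⟩ := h X g
        cases hv with
        | comp _ hy' hx' hc =>
          refine (val_mk (.comp hkm hy' hx' hc)).trans
            (Eq.trans ?_ ((valMagma X g b).map_comp hkm _ _ _).symm)
          exact Magma.comp_congr _ _ (val_mk hy').symm (val_mk hx').symm _
    rw [e]
    exact ((freeCar f b).map_comp hkm _ _ _).trans
      ((Magma.comp_congr _ _ (ihy hk hy) (ihx hk hx) _).trans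
        ((valMagma X g b).map_comp hkm _ _ _).symm)
  | @phi k x ih =>
    have h' : ∀ (X : QObj.{u} n) (g : RGHom A X.top.toRGSet), ∃ v, Ev X g x v := fun X g => by
      obtain ⟨v, hv⟩ := h X g
      cases hv with | phi hv => exact ⟨_, hv⟩
    have e : (FreeCell.mk (.phi x) hk h : (freeMagma A false).cell k) =
        (freePhi A).app (FreeCell.mk x hk h') := freeMagma_ext fun X g => by
      obtain ⟨v, hv⟩ := h' X g
      refine (val_mk (.phi hv)).trans (Eq.trans ?_ (val_freePhi X g _).symm)
      exact congrArg X.φ.app (val_mk hv).symm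
    rw [e]
    exact (QHom.comm f _).symm.trans
      ((congrArg X.φ.app (ih hk h')).trans (val_freePhi X g _).symm)
  | @con k x y ihx ihy =>
    have hx : ∀ (X : QObj.{u} n) (g : RGHom A X.top.toRGSet), ∃ v, Ev X g x v := fun X g => by
      obtain ⟨v, hv⟩ := h X g
      cases hv with | con _ hv _ _ _ => exact ⟨_, hv⟩
    have hy : ∀ (X : QObj.{u} n) (g : RGHom A X.top.toRGSet), ∃ v, Ev X g y v := fun X g => by
      obtain ⟨v, hv⟩ := h X g
      cases hv with | con _ _ hv _ _ => exact ⟨_, hv⟩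
    have hk' := Nat.le_of_succ_le hk
    have hp : RGSet.Parallel (A := (freeMagma A true).toRGSet) (FreeCell.mk x hk' hx)
        (FreeCell.mk y hk' hy) := by
      cases k with
      | zero => trivial
      | succ k =>
        refine ⟨freeMagma_ext fun X g => ?_, freeMagma_ext fun X g => ?_⟩
        · obtain ⟨v, hv⟩ := h X g
          cases hv with
          | con _ hx' hy' hp _ =>
            refine ((valMagma X g true).map_s _).trans
              (Eq.trans ?_ ((valMagma X g true).map_s _).symm)
            refine (congrArg (X.car true).s (val_mk hx')).trans (hp.1.trans ?_)
            exact congrArg (X.car true).s (val_mk hy').symm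
        · obtain ⟨v, hv⟩ := h X g
          cases hv with
          | con _ hx' hy' hp _ =>
            refine ((valMagma X g true).map_t _).trans
              (Eq.trans ?_ ((valMagma X g true).map_t _).symm)
            refine (congrArg (X.car true).t (val_mk hx')).trans (hp.2.trans ?_)
            exact congrArg (X.car true).t (val_mk hy').symm
    have hf' : (freePhi A).app (FreeCell.mk x hk' hx) = (freePhi A).app (FreeCell.mk y hk' hy) :=
      freeMagma_ext fun X g => by
        obtain ⟨v, hv⟩ := h X g
        cases hv with
        | con _ hx' hy' _ hq =>
          refine (val_freePhi X g _).trans (Eq.trans ?_ (val_freePhi X g _).symm)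
          refine (congrArg X.φ.app (val_mk hx')).trans (hq.trans ?_)
          exact congrArg X.φ.app (val_mk hy').symm
    have e : (FreeCell.mk (.con x y) hk h : (freeMagma A true).cell (k + 1)) =
        freeConCell hk (FreeCell.mk x hk' hx) (FreeCell.mk y hk' hy) hp hf' :=
      freeMagma_ext fun X g => by
        obtain ⟨v, hv⟩ := h X g
        cases hv with
        | con _ hx' hy' hp hq =>
          refine (val_mk (.con hk hx' hy' hp hq)).trans
            (Eq.trans ?_ (val_freeConCell X g hk _ _ _ _).symm)
          exact X.con.cell_congr hk (val_mk hx').symm (val_mk hy').symm _ _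
    rw [e]
    exact (QHom.map_con f hk _ _ hp hf').trans
      ((X.con.cell_congr hk (ihx hk' hx) (ihy hk' hy) _ _).trans
        (val_freeConCell X g hk _ _ hp hf').symm)

theorem freeLift_unique (X : QObj.{u} n) (f : freeQ A ⟶ X) (g : A ⟶ (forgetQ n).obj X)
    (hf : freeUnit A ≫ (forgetQ n).map f = g) : freeLift X g = f := by
  have key : ∀ (b : Bool) {k : ℕ} (q : (freeMagma A b).cell k),
      (freeCar f b).app q = (valMagma X g b).app q := fun b k q => by
    rw [← FreeCell.mk_rep q]
    exact freeCar_eq X f g hf _ _ _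
  apply QHom.ext
  · apply MagmaHom.ext
    funext k q
    exact (key true q).symm
  · apply MagmaHom.ext
    funext k q
    exact (key false q).symm

/-- The universal property of the free object. -/
noncomputable def freeEquiv (A : RGSet.{u} n) (X : QObj.{u} n) :
    (freeQ A ⟶ X) ≃ (A ⟶ (forgetQ n).obj X) where
  toFun f := freeUnit A ≫ (forgetQ n).map f
  invFun g := freeLift X g
  left_inv f := freeLift_unique X f _ rfl
  right_inv g := freeUnit_lift X g

end Free

/-- The free functor `F : RGSet ⥤ 𝒬`. -/
noncomputable def freeFunctor (n : ℕ) : RGSet.{u} n ⥤ QObj.{u} n :=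
  Adjunction.leftAdjointOfEquiv (G := forgetQ n) (F_obj := freeQ) freeEquiv
    fun A X Y g h => by simp [freeEquiv]

/-- The adjunction `F ⊣ U`. -/
noncomputable def freeAdj (n : ℕ) : freeFunctor.{u} n ⊣ forgetQ.{u} n :=
  Adjunction.adjunctionOfEquivLeft freeEquiv _

/-- The monad `Pₙ` on `n`-dimensional reflexive globular sets. -/
noncomputable def penonMonad (n : ℕ) : Monad (RGSet.{u} n) := (freeAdj n).toMonad

/-- A Penon `n`-category is an algebra for the monad `Pₙ`. -/
abbrev PenonCat (n : ℕ) : Type (u + 1) := (penonMonad.{u} n).Algebra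

/-! ### Penon `n`-categories -/

section Algebra

variable {n : ℕ} (A : PenonCat.{u} n)

/-- The free object `φ : PA → T_R A` of `𝒬` on the underlying reflexive globular set of `A`; its top
magma has underlying reflexive globular set `PA`. -/
noncomputable def freeOn : QObj.{u} n := (freeFunctor n).obj A.A

/-- The unit `η : A → PA`. -/
noncomputable def unitMap : RGHom A.A (freeOn A).top.toRGSet := (penonMonad n).η.app A.A

/-- The algebra structure `θ : PA → A`. -/
def actMap : RGHom (freeOn A).top.toRGSet A.A := A.a

/-- Composition in the Penon `n`-category `A`: the formal composite in `PA`, evaluated by `θ`. -/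
noncomputable def compA {m : ℕ} (k : ℕ) (h : k < m) (y x : A.A.cell m)
    (hc : A.A.Composable h y x) : A.A.cell m :=
  (actMap A).app
    ((freeOn A).top.comp k h ((unitMap A).app y) ((unitMap A).app x) ((unitMap A).composable hc))

variable {A}

theorem act_unit {k : ℕ} (x : A.A.cell k) : (actMap A).app ((unitMap A).app x) = x :=
  congrArg (fun f : RGHom A.A A.A => f.app x) A.unit

/-- Evaluating the factors of a formal composite first does not change its value. -/
theorem act_comp {k m : ℕ} (h : k < m) (y x : (freeOn A).top.cell m)
    (hc : (freeOn A).top.Composable h y x) :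
    compA A k h ((actMap A).app y) ((actMap A).app x) ((actMap A).composable hc) =
      (actMap A).app ((freeOn A).top.comp k h y x hc) := by
  let P := (freeOn A).top.toRGSet
  let e : RGHom P ((freeFunctor n).obj P).top.toRGSet := (freeAdj n).unit.app P
  let μ : QHom ((freeFunctor n).obj P) (freeOn A) := (freeAdj n).counit.app (freeOn A)
  let Pθ : QHom ((freeFunctor n).obj P) (freeOn A) := (freeFunctor n).map A.a
  have h1 : ∀ {k : ℕ} (z : P.cell k), μ.top.app (e.app z) = z := fun z =>
    congrArg (fun f : RGHom P P => f.app z) ((freeAdj n).right_triangle_components (freeOn A))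
  have h2 : ∀ {k : ℕ} (z : P.cell k),
      Pθ.top.app (e.app z) = (unitMap A).app ((actMap A).app z) := fun z =>
    (congrArg (fun f : RGHom P P => f.app z) ((freeAdj n).unit.naturality A.a)).symm
  have h3 : ∀ {k : ℕ} (z : ((freeFunctor n).obj P).top.cell k),
      (actMap A).app (μ.top.app z) = (actMap A).app (Pθ.top.app z) := fun z =>
    congrArg (fun f : RGHom ((freeFunctor n).obj P).top.toRGSet A.A => f.app z) A.assoc
  have h4 := h3 (((freeFunctor n).obj P).top.comp k h (e.app y) (e.app x) (e.composable hc))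
  rw [μ.top.map_comp, Pθ.top.map_comp] at h4
  rw [Magma.comp_congr _ h (h1 y) (h1 x), Magma.comp_congr _ h (h2 y) (h2 x)] at h4
  exact h4.symm

end Algebra

/-! ### The category of 2-cells and 3-cells of a Penon 3-category -/

/-- The 2-cells of a Penon 3-category. -/
def TwoCell (A : PenonCat.{u} 3) : Type u := A.A.cell 2

/-- The 3-cells from `α` to `β`. -/
@[ext]
structure ThreeCell {A : PenonCat.{u} 3} (α β : TwoCell A) : Type u where
  cell : A.A.cell 3
  s_cell : A.A.s cell = α
  t_cell : A.A.t cell = β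

section TwoThree

variable {A : PenonCat.{u} 3}

theorem composable_of_eq {f g : A.A.cell 3} (h : A.A.t f = A.A.s g) :
    A.A.Composable (k := 2) (by decide) g f := by
  simpa [RGSet.Composable] using h

/-- Composition of 3-cells along 2-cells. -/
noncomputable def ThreeCell.comp {α β γ : TwoCell A} (f : ThreeCell α β) (g : ThreeCell β γ) :
    ThreeCell α γ where
  cell := compA A 2 (by decide) g.cell f.cell (composable_of_eq (f.t_cell.trans g.s_cell.symm))
  s_cell := by
    rw [compA, ← RGHom.map_s, Magma.s_comp_top, ← RGHom.map_s, act_unit, f.s_cell]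
  t_cell := by
    rw [compA, ← RGHom.map_t, Magma.t_comp_top, ← RGHom.map_t, act_unit, g.t_cell]

/-- The identity 3-cell. -/
def ThreeCell.id (α : TwoCell A) : ThreeCell α α where
  cell := A.A.i (by decide) α
  s_cell := A.A.s_i _ _
  t_cell := A.A.t_i _ _

theorem compA_id (f : A.A.cell 3) (hc : A.A.Composable (k := 2) (by decide) f
    (A.A.i (by decide) (A.A.s f))) :
    compA A 2 (by decide) f (A.A.i (by decide) (A.A.s f)) hc = f := by
  refine Eq.trans ?_ (act_unit f)
  refine congrArg (actMap A).app ((freeOn A).con.eq_of_top _ _ ⟨?_, ?_⟩ ?_)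
  · rw [Magma.s_comp_top, ← RGHom.map_s, ← RGHom.map_s, A.A.s_i]
  · rw [Magma.t_comp_top]
  · rw [MagmaHom.map_comp]
    refine Eq.trans ?_ ((freeOn A).base.comp_id (k := 2) (by decide) _)
    refine Magma.comp_congr _ _ rfl ?_ _
    rw [RGHom.map_i, RGHom.map_i, RGSet.iTo_succ _ le_rfl, RGSet.iTo_self, RGSet.sTo_one,
      RGHom.map_s, RGHom.map_s]

theorem id_compA (f : A.A.cell 3) (hc : A.A.Composable (k := 2) (by decide)
    (A.A.i (by decide) (A.A.t f)) f) :
    compA A 2 (by decide) (A.A.i (by decide) (A.A.t f)) f hc = f := by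
  refine Eq.trans ?_ (act_unit f)
  refine congrArg (actMap A).app ((freeOn A).con.eq_of_top _ _ ⟨?_, ?_⟩ ?_)
  · rw [Magma.s_comp_top]
  · rw [Magma.t_comp_top, ← RGHom.map_t, ← RGHom.map_t, A.A.t_i]
  · rw [MagmaHom.map_comp]
    refine Eq.trans ?_ ((freeOn A).base.id_comp (k := 2) (by decide) _)
    refine Magma.comp_congr _ _ ?_ rfl _
    rw [RGHom.map_i, RGHom.map_i, RGSet.iTo_succ _ le_rfl, RGSet.iTo_self, RGSet.tTo_one,
      RGHom.map_t, RGHom.map_t]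

theorem compA_congr {k m : ℕ} (h : k < m) {y y' x x' : A.A.cell m} (hy : y = y') (hx : x = x')
    (hc : A.A.Composable h y x) :
    compA A k h y x hc = compA A k h y' x' (hy ▸ hx ▸ hc) := by
  subst hy hx; rfl

theorem ThreeCell.comp_assoc {α β γ δ : TwoCell A} (f : ThreeCell α β) (g : ThreeCell β γ)
    (h : ThreeCell γ δ) : (f.comp g).comp h = f.comp (g.comp h) := by
  have hgf := (unitMap A).composable (composable_of_eq (f.t_cell.trans g.s_cell.symm))
  have hhg := (unitMap A).composable (composable_of_eq (g.t_cell.trans h.s_cell.symm))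
  apply ThreeCell.ext
  have h1 := act_comp _ _ _ (Magma.composable_comp_right hhg hgf)
  have h2 := act_comp _ _ _ (Magma.composable_comp_left hhg hgf)
  rw [compA_congr _ (act_unit h.cell) rfl] at h1
  rw [compA_congr _ rfl (act_unit f.cell)] at h2
  refine h1.trans (Eq.trans ?_ h2.symm)
  refine congrArg (actMap A).app ((freeOn A).con.eq_of_top _ _ ⟨?_, ?_⟩ ?_)
  · simp only [Magma.s_comp_top]
  · simp only [Magma.t_comp_top]
  · simp only [MagmaHom.map_comp]
    exact ((freeOn A).base.assoc _ _ _ _ _ _).symm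

/-- The category whose objects are the 2-cells and whose morphisms are the 3-cells of `A`. -/
noncomputable instance : Category (TwoCell A) where
  Hom α β := ThreeCell α β
  id α := ThreeCell.id α
  comp f g := f.comp g
  id_comp f := by
    obtain ⟨f, rfl, rfl⟩ := f
    exact ThreeCell.ext (compA_id f (composable_of_eq (A.A.t_i _ _)))
  comp_id f := by
    obtain ⟨f, rfl, rfl⟩ := f
    exact ThreeCell.ext (id_compA f (composable_of_eq (A.A.s_i _ _).symm))
  assoc f g h := f.comp_assoc g h

end TwoThree

/-! ### Doubly degenerate Penon 3-categories -/

/-- Doubly degenerate: there is exactly one 0-cell and exactly one 1-cell. -/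
structure IsDoublyDegenerate {n : ℕ} (A : RGSet.{u} n) : Prop where
  zero : Nonempty (Unique (A.cell 0))
  one : Nonempty (Unique (A.cell 1))

section DoublyDegenerate

variable {A : PenonCat.{u} 3}

/-- In a doubly degenerate 3-category any two 2-cells, and any two 3-cells, can be composed along
the unique 1-cell. -/
theorem IsDoublyDegenerate.composable {n : ℕ} {A : RGSet.{u} n} (hA : IsDoublyDegenerate A)
    {m : ℕ} (h : 1 < m) (y x : A.cell m) : A.Composable h y x := by
  obtain ⟨_⟩ := hA.one
  exact Subsingleton.elim _ _

/-- The cell `x ∘₁ y` of `A`. -/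
noncomputable def tensorCell (hA : IsDoublyDegenerate A.A) {m : ℕ} (h : 1 < m)
    (x y : A.A.cell m) : A.A.cell m :=
  compA A 1 h x y (hA.composable h x y)

/-- The identity 2-cell on the identity 1-cell on the unique 0-cell. -/
noncomputable def unitCell (hA : IsDoublyDegenerate A.A) : TwoCell A :=
  A.A.i (k := 1) (by decide) (A.A.i (k := 0) (by decide) hA.zero.some.default)

/-- A 2-cell of `A` as a cell of `PA`. -/
noncomputable def formal (α : TwoCell A) : (freeOn A).top.cell 2 := (unitMap A).app (k := 2) α

theorem formal_composable (hA : IsDoublyDegenerate A.A) (α β : TwoCell A) :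
    (freeOn A).top.Composable (k := 1) (by decide) (formal α) (formal β) :=
  (unitMap A).composable (hA.composable (m := 2) (by decide) α β)

/-- The formal composite `α ∘₁ β` in `PA`. -/
noncomputable def formalTwo (hA : IsDoublyDegenerate A.A) (α β : TwoCell A) :
    (freeOn A).top.cell 2 :=
  (freeOn A).top.comp 1 (by decide) (formal α) (formal β) (formal_composable hA α β)

/-- The formal composite `(α ∘₁ β) ∘₁ γ` in `PA`. -/
noncomputable def formalLeft (hA : IsDoublyDegenerate A.A) (α β γ : TwoCell A) :
    (freeOn A).top.cell 2 :=
  (freeOn A).top.comp 1 (by decide) (formalTwo hA α β) (formal γ)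
    (Magma.composable_comp_left (formal_composable hA α β) (formal_composable hA β γ))

/-- The formal composite `α ∘₁ (β ∘₁ γ)` in `PA`. -/
noncomputable def formalRight (hA : IsDoublyDegenerate A.A) (α β γ : TwoCell A) :
    (freeOn A).top.cell 2 :=
  (freeOn A).top.comp 1 (by decide) (formal α) (formalTwo hA β γ)
    (Magma.composable_comp_right (formal_composable hA α β) (formal_composable hA β γ))

end DoublyDegenerate

/-- The 3-cell `c` of `A` is the value `θ[x, y]` of a contraction cell `[x, y]` of `PA`; in
particular this contraction cell exists, i.e. `x` and `y` are parallel and `φ x = φ y`. -/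
def IsContractionValue {A : PenonCat.{u} 3} (x y : (freeOn A).top.cell 2) (c : A.A.cell 3) :
    Prop :=
  ∃ (hp : RGSet.Parallel x y) (hφ : (freeOn A).φ.app x = (freeOn A).φ.app y),
    c = (actMap A).app ((freeOn A).con.cell (by decide) x y hp hφ)

/-- `ι : A → B` exhibits `B` as the free strict `n`-category on `A`. -/
def IsFreeStrictCat {n : ℕ} (A : RGSet.{u} n) (B : StrictCat.{u} n) (ι : RGHom A B.toRGSet) :
    Prop :=
  ∀ (C : StrictCat.{u} n) (g : RGHom A C.toRGSet),
    ∃! f : MagmaHom B.toMagma C.toMagma, ι.comp f.toRGHom = g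

/-- Contraction cells `[x, y]` and `[y, x]` can be composed. -/
theorem composable_con {n : ℕ} (X : QObj.{u} n) {k : ℕ} (hk : k < n) {x y : X.top.cell k}
    (hp : RGSet.Parallel x y) (hφ : X.φ.app x = X.φ.app y)
    (hp' : RGSet.Parallel y x) (hφ' : X.φ.app y = X.φ.app x) :
    X.top.Composable (Nat.lt_succ_self k) (X.con.cell hk x y hp hφ) (X.con.cell hk y x hp' hφ') :=
  Magma.composable_top ((X.con.t_cell hk y x _ _).trans (X.con.s_cell hk x y _ _).symm)

end Penon

open CategoryTheory MonoidalCategory Penon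

/-!
In `PA` a contraction cell maps to an identity of the strict base `T_R A`, and a 3-cell is
determined by its source, its target and its image in the base. Hence any two parallel 3-cells built
from contraction cells and identities are equal, and any law between 3-cells that holds in a strict
3-category up to such coherent cells holds in `PA`. Under composition along `o = i(η(*))`, the
endomorphisms of `o` in `PA` therefore form a monoidal category whose constraints are contraction
cells. As `o` is an identity cell, composition along it is commutative in the base by the
Eckmann–Hilton argument, so the contraction cells `[y ∘ x, x ∘ y]` exist too, and they make this
monoidal category symmetric.

This structure descends along `θ` to `A`. For a 2-cell `x` of `PA`, the constraints of `A` at `θ x`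
are defined by contraction cells at `η(θ x)` rather than at `x`; both are images, under `Pθ` and
under the multiplication `μ`, of the contraction cell at `η x` in `PPA`, and `θμ = θ(Pθ)`.
-/

namespace Penon

/-! ### Endomorphisms of a cell -/

theorem RGSet.iTo_i {n : ℕ} (A : RGSet.{u} n) {k m : ℕ} (h : k + 1 ≤ m) (hm : m ≤ n)
    (x : A.cell k) :
    A.iTo h hm (A.i (h.trans hm) x) = A.iTo (k.le_succ.trans h) hm x := by
  induction m, h using Nat.le_induction with
  | base => rw [A.iTo_self, A.iTo_succ le_rfl, A.iTo_self]
  | succ m h ih => rw [A.iTo_succ h, A.iTo_succ (k.le_succ.trans h), ih]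

theorem StrictCat.comp_i_of_s_eq {n m : ℕ} (B : StrictCat.{u} n) (hm : m < n) {x : B.cell (m + 1)}
    {w : B.cell m} (hw : B.s x = w) (hc : B.Composable m.lt_succ_self x (B.i hm w)) :
    B.comp m m.lt_succ_self x (B.i hm w) hc = x := by
  subst hw
  refine Eq.trans (B.comp_congr _ rfl ?_ _) (B.comp_id m.lt_succ_self x)
  rw [B.iTo_succ le_rfl, B.iTo_self, B.sTo_one]

theorem StrictCat.i_comp_of_t_eq {n m : ℕ} (B : StrictCat.{u} n) (hm : m < n) {x : B.cell (m + 1)}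
    {w : B.cell m} (hw : B.t x = w) (hc : B.Composable m.lt_succ_self (B.i hm w) x) :
    B.comp m m.lt_succ_self (B.i hm w) x hc = x := by
  subst hw
  refine Eq.trans (B.comp_congr _ ?_ rfl _) (B.id_comp m.lt_succ_self x)
  rw [B.iTo_succ le_rfl, B.iTo_self, B.tTo_one]

/-- The `m`-cells whose iterated source and target in dimension `k` are the `k`-cell `o`, that is,
the endomorphisms of `o` of dimension `m`. Any two of them can be composed along `o`. -/
@[ext]
structure EndCell {n : ℕ} (A : RGSet.{u} n) {k : ℕ} (o : A.cell k) {m : ℕ} (h : k < m) where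
  cell : A.cell m
  sTo_cell : A.sTo h.le cell = o
  tTo_cell : A.tTo h.le cell = o

namespace EndCell

section RGSet

variable {n k m : ℕ} {h : k < m} {A B : RGSet.{u} n} {o : A.cell k}

theorem composable (y x : EndCell A o h) : A.Composable h y.cell x.cell :=
  x.tTo_cell.trans y.sTo_cell.symm

theorem parallel {h : k < k + 1} (x y : EndCell A o h) : RGSet.Parallel x.cell y.cell := by
  constructor
  · simpa only [RGSet.sTo_one] using x.sTo_cell.trans y.sTo_cell.symm
  · simpa only [RGSet.tTo_one] using x.tTo_cell.trans y.tTo_cell.symm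

/-- The image of an endomorphism of `o` under a map of reflexive globular sets, as an endomorphism
of a cell `o'` that is only propositionally the image of `o`. -/
def map (f : RGHom A B) {o' : B.cell k} (ho : f.app o = o') (x : EndCell A o h) :
    EndCell B o' h where
  cell := f.app x.cell
  sTo_cell := by rw [← f.map_sTo, x.sTo_cell, ho]
  tTo_cell := by rw [← f.map_tTo, x.tTo_cell, ho]

/-- The iterated identity on `o`, as an endomorphism. -/
def one (o : A.cell k) (h : k < m) (hm : m ≤ n) : EndCell A o h where
  cell := A.iTo h.le hm o
  sTo_cell := A.sTo_iTo _ _ _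
  tTo_cell := A.tTo_iTo _ _ _

theorem map_one (f : RGHom A B) {o' : B.cell k} (ho : f.app o = o') (h : k < m) (hm : m ≤ n) :
    (one o h hm).map f ho = one o' h hm := by
  subst ho
  exact EndCell.ext (f.map_iTo _ _ _)

end RGSet

section Magma

variable {n k m : ℕ} {h : k < m} {M N : Magma.{u} n} {o : M.cell k}

instance : Mul (EndCell M.toRGSet o h) where
  mul y x :=
    { cell := M.comp k h y.cell x.cell (composable y x)
      sTo_cell := by rw [M.sTo_comp, x.sTo_cell]
      tTo_cell := by rw [M.tTo_comp, y.tTo_cell] }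

theorem mul_cell (y x : EndCell M.toRGSet o h) :
    (y * x).cell = M.comp k h y.cell x.cell (composable y x) := rfl

theorem map_mul (f : MagmaHom M N) {o' : N.cell k} (ho : f.app o = o')
    (y x : EndCell M.toRGSet o h) :
    (y * x).map f.toRGHom ho = y.map f.toRGHom ho * x.map f.toRGHom ho :=
  EndCell.ext (f.map_comp h _ _ _)

end Magma

section StrictCat

variable {n k m : ℕ} {h : k < m} {B : StrictCat.{u} n} {o : B.cell k}

instance : Semigroup (EndCell B.toRGSet o h) where
  mul_assoc z y x := EndCell.ext (B.assoc h z.cell y.cell x.cell _ _)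

protected theorem one_mul (hm : m ≤ n) (x : EndCell B.toRGSet o h) : one o h hm * x = x := by
  refine EndCell.ext (Eq.trans ?_ (B.id_comp h x.cell))
  exact B.comp_congr _ (by rw [x.tTo_cell]; rfl) rfl _

protected theorem mul_one (hm : m ≤ n) (x : EndCell B.toRGSet o h) : x * one o h hm = x := by
  refine EndCell.ext (Eq.trans ?_ (B.comp_id h x.cell))
  exact B.comp_congr _ rfl (by rw [x.sTo_cell]; rfl) _

end StrictCat

section EckmannHilton

variable {n j m : ℕ} {h : j + 1 < m} {B : StrictCat.{u} n} {hj : j < n} {w : B.cell j}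

theorem sTo_cell_i {A : RGSet.{u} n} {w : A.cell j} (x : EndCell A (A.i hj w) h) :
    A.sTo (j.le_succ.trans h.le) x.cell = w := by
  rw [← A.sTo_sTo j.le_succ h.le, x.sTo_cell, A.sTo_one, A.s_i]

theorem tTo_cell_i {A : RGSet.{u} n} {w : A.cell j} (x : EndCell A (A.i hj w) h) :
    A.tTo (j.le_succ.trans h.le) x.cell = w := by
  rw [← A.tTo_tTo j.le_succ h.le, x.tTo_cell, A.tTo_one, A.t_i]

theorem composable_i {A : RGSet.{u} n} {w : A.cell j} (y x : EndCell A (A.i hj w) h) :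
    A.Composable (j.lt_succ_self.trans h) y.cell x.cell :=
  x.tTo_cell_i.trans y.sTo_cell_i.symm

/-- The second product of endomorphisms of an identity cell `1_w`: composition along `w`. -/
def hcomp (y x : EndCell B.toRGSet (B.i hj w) h) : EndCell B.toRGSet (B.i hj w) h where
  cell := B.comp j (j.lt_succ_self.trans h) y.cell x.cell (composable_i y x)
  sTo_cell := by
    rw [B.sTo_comp_lt j.lt_succ_self h.le]
    exact (B.comp_congr _ y.sTo_cell x.sTo_cell _).trans (B.comp_i_of_s_eq hj (B.s_i _ _) _)
  tTo_cell := by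
    rw [B.tTo_comp_lt j.lt_succ_self h.le]
    exact (B.comp_congr _ y.tTo_cell x.tTo_cell _).trans (B.comp_i_of_s_eq hj (B.s_i _ _) _)

theorem one_i_cell (hm : m ≤ n) : (one (B.i hj w) h hm).cell =
    B.iTo (j.le_succ.trans h.le) hm w :=
  B.iTo_i h.le hm w

theorem one_hcomp (hm : m ≤ n) (x : EndCell B.toRGSet (B.i hj w) h) :
    hcomp (one _ h hm) x = x := by
  refine EndCell.ext (Eq.trans ?_ (B.id_comp (j.lt_succ_self.trans h) x.cell))
  exact B.comp_congr _ (by rw [one_i_cell, x.tTo_cell_i]) rfl _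

theorem hcomp_one (hm : m ≤ n) (x : EndCell B.toRGSet (B.i hj w) h) :
    hcomp x (one _ h hm) = x := by
  refine EndCell.ext (Eq.trans ?_ (B.comp_id (j.lt_succ_self.trans h) x.cell))
  exact B.comp_congr _ rfl (by rw [one_i_cell, x.sTo_cell_i]) _

theorem hcomp_mul_mul (a b c d : EndCell B.toRGSet (B.i hj w) h) :
    hcomp (a * b) (c * d) = hcomp a c * hcomp b d :=
  EndCell.ext (B.interchange j.lt_succ_self h _ _ _ _ _ _ _)

theorem mul_comm_of_eq_i {o : B.cell (j + 1)} (ho : o = B.i hj w)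
    (y x : EndCell B.toRGSet o h) : y * x = x * y := by
  subst ho
  have hm : m ≤ n := B.dim_le x.cell
  have unital_hcomp : EckmannHilton.IsUnital hcomp (one (B.i hj w) h hm) :=
    { left_id := one_hcomp hm, right_id := hcomp_one hm }
  have unital_mul : EckmannHilton.IsUnital (· * ·) (one (B.i hj w) h hm) :=
    { left_id := EndCell.one_mul hm, right_id := EndCell.mul_one hm }
  exact (EckmannHilton.mul_comm unital_hcomp unital_mul hcomp_mul_mul).comm y x

end EckmannHilton

end EndCell

/-! ### The base of a free object -/

/-- A strict `n`-category as the object `1 : C → C` of `𝒬`. -/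
def StrictCat.toQObj {n : ℕ} (C : StrictCat.{u} n) : QObj.{u} n where
  top := C.toMagma
  base := C
  φ := MagmaHom.id C.toMagma
  con :=
    { cell hk x _ _ _ := C.i hk x
      s_cell hk x _ _ _ := C.s_i hk x
      t_cell hk x _ _ hf := (C.t_i hk x).trans hf
      map_cell _ _ _ _ _ := rfl
      cell_self _ _ _ _ := rfl
      eq_of_top _ _ _ hf := hf }

/-- Taking bases is left adjoint to `StrictCat.toQObj`. -/
def QObj.homToQObjEquiv {n : ℕ} (X : QObj.{u} n) (C : StrictCat.{u} n) :
    (X ⟶ C.toQObj) ≃ MagmaHom X.base.toMagma C.toMagma where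
  toFun f := QHom.base f
  invFun f :=
    { top := X.φ.comp f
      base := f
      comm _ := rfl
      map_con hk x y hp hf := (congrArg f.app (X.con.map_cell hk x y hp hf)).trans (f.map_i hk _) }
  left_inv f := by
    refine QHom.ext (MagmaHom.ext ?_) rfl
    funext k x
    exact (f.comm x).symm
  right_inv _ := rfl

theorem isFreeStrictCat_of_adjunction {n : ℕ} {F : RGSet.{u} n ⥤ QObj.{u} n}
    (adj : F ⊣ forgetQ n) (A : RGSet.{u} n) :
    IsFreeStrictCat A (F.obj A).base (RGHom.comp (adj.unit.app A) (F.obj A).φ.toRGHom) := by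
  intro C g
  let e := ((F.obj A).homToQObjEquiv C).symm.trans (adj.homEquiv A C.toQObj)
  have he (f : MagmaHom (F.obj A).base.toMagma C.toMagma) :
      e f = (RGHom.comp (adj.unit.app A) (F.obj A).φ.toRGHom).comp f.toRGHom :=
    adj.homEquiv_unit _ _ _
  refine ⟨e.symm g, (he _).symm.trans (e.apply_symm_apply g), fun f hf => ?_⟩
  exact e.eq_symm_apply.2 ((he f).trans hf)

/-! ### Coherent cells -/

/-- The `(m + 1)`-cells from the `m`-cell `x` to the `m`-cell `y`. -/
@[ext]
structure CellHom {n : ℕ} {A : RGSet.{u} n} {m : ℕ} (x y : A.cell m) where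
  cell : A.cell (m + 1)
  s_cell : A.s cell = x
  t_cell : A.t cell = y

namespace CellHom

section Magma

variable {n m : ℕ} {M : Magma.{u} n} {x y z : M.cell m}

/-- The putative identity on `x`. -/
def id (hm : m < n) (x : M.cell m) : CellHom x x where
  cell := M.i hm x
  s_cell := M.s_i _ _
  t_cell := M.t_i _ _

/-- Composition along `m`-cells, in diagrammatic order. -/
def comp (c : CellHom x y) (d : CellHom y z) : CellHom x z where
  cell := M.comp m m.lt_succ_self d.cell c.cell
    (Magma.composable_top (c.t_cell.trans d.s_cell.symm))
  s_cell := by rw [M.s_comp_top, c.s_cell]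
  t_cell := by rw [M.t_comp_top, d.t_cell]

end Magma

section QObj

variable {n m : ℕ} {X : QObj.{u} n} {x y z : X.top.cell m}

/-- The contraction cell `[x, y]`. -/
def con (hm : m < n) (hp : RGSet.Parallel x y) (hφ : X.φ.app x = X.φ.app y) : CellHom x y where
  cell := X.con.cell hm x y hp hφ
  s_cell := X.con.s_cell _ _ _ _ _
  t_cell := X.con.t_cell _ _ _ _ _

/-- A cell of the top magma is coherent if it becomes an identity in the base. Contraction cells
are coherent, and in top dimension parallel coherent cells are equal. -/
class IsCoherent (c : CellHom x y) : Prop where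
  map_cell : X.φ.app c.cell = X.base.i (X.top.dim_le c.cell) (X.φ.app x)

theorem IsCoherent.map_source_eq (c : CellHom x y) [hc : c.IsCoherent] :
    X.φ.app x = X.φ.app y := by
  rw [← c.t_cell, X.φ.map_t, hc.map_cell, X.base.t_i]

theorem map_coherent_comp (c : CellHom x y) [hc : c.IsCoherent] (d : CellHom y z) :
    X.φ.app (c.comp d).cell = X.φ.app d.cell := by
  refine (X.φ.map_comp _ _ _ _).trans ((X.base.comp_congr _ rfl hc.map_cell _).trans ?_)
  refine X.base.comp_i_of_s_eq _ ?_ _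
  rw [← X.φ.map_s, d.s_cell, IsCoherent.map_source_eq c]

theorem map_comp_coherent (c : CellHom x y) (d : CellHom y z) [hd : d.IsCoherent] :
    X.φ.app (c.comp d).cell = X.φ.app c.cell := by
  refine (X.φ.map_comp _ _ _ _).trans ((X.base.comp_congr _ hd.map_cell rfl _).trans ?_)
  refine X.base.i_comp_of_t_eq _ ?_ _
  rw [← X.φ.map_t, c.t_cell]

instance (hm : m < n) (x : X.top.cell m) : (id hm x).IsCoherent where
  map_cell := X.φ.map_i _ _

instance (hm : m < n) (hp : RGSet.Parallel x y) (hφ : X.φ.app x = X.φ.app y) :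
    (con hm hp hφ).IsCoherent where
  map_cell := X.con.map_cell _ _ _ _ _

instance (c : CellHom x y) (d : CellHom y z) [hc : c.IsCoherent] [d.IsCoherent] :
    (c.comp d).IsCoherent where
  map_cell := (map_comp_coherent c d).trans hc.map_cell

end QObj

section Top

variable {m : ℕ} {X : QObj.{u} (m + 1)} {x y z w : X.top.cell m}

theorem ext_of_map {c d : CellHom x y} (e : X.φ.app c.cell = X.φ.app d.cell) : c = d :=
  CellHom.ext (X.con.eq_of_top _ _
    ⟨c.s_cell.trans d.s_cell.symm, c.t_cell.trans d.t_cell.symm⟩ e)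

theorem IsCoherent.eq (c d : CellHom x y) [hc : c.IsCoherent] [hd : d.IsCoherent] : c = d :=
  ext_of_map (hc.map_cell.trans hd.map_cell.symm)

theorem id_comp (c : CellHom x y) : (id m.lt_succ_self x).comp c = c :=
  ext_of_map (map_coherent_comp _ c)

theorem comp_id (c : CellHom x y) : c.comp (id m.lt_succ_self y) = c :=
  ext_of_map (map_comp_coherent c _)

theorem assoc (c : CellHom x y) (d : CellHom y z) (e : CellHom z w) :
    (c.comp d).comp e = c.comp (d.comp e) := by
  refine ext_of_map ?_
  simp only [comp, MagmaHom.map_comp]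
  exact (X.base.assoc _ _ _ _ _ _).symm

theorem con_comp_con_symm (hp : RGSet.Parallel x y) (hφ : X.φ.app x = X.φ.app y)
    (hp' : RGSet.Parallel y x) :
    (con m.lt_succ_self hp hφ).comp (con m.lt_succ_self hp' hφ.symm) = id m.lt_succ_self x :=
  IsCoherent.eq _ _

end Top

end CellHom

/-! ### The monoidal category of endomorphisms of a cell -/

namespace EndCell

variable {n k m : ℕ} {h : k < m} {X : QObj.{u} n} {o : X.top.cell k}

/-- The image in the base of an endomorphism. -/
abbrev phi (x : EndCell X.top.toRGSet o h) : EndCell X.base.toRGSet (X.φ.app o) h :=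
  x.map X.φ.toRGHom rfl

theorem phi_mul (x y : EndCell X.top.toRGSet o h) : (x * y).phi = x.phi * y.phi :=
  map_mul X.φ rfl x y

theorem phi_one (hm : m ≤ n) :
    (one o h hm : EndCell X.top.toRGSet o h).phi = one (X.φ.app o) h hm :=
  map_one X.φ.toRGHom rfl h hm

theorem phi_mul_assoc (x y z : EndCell X.top.toRGSet o h) :
    (x * y * z).phi = (x * (y * z)).phi := by
  simp only [phi_mul, mul_assoc]

theorem phi_one_mul (hm : m ≤ n) (x : EndCell X.top.toRGSet o h) :
    (one o h hm * x).phi = x.phi := by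
  rw [phi_mul, phi_one, EndCell.one_mul]

theorem phi_mul_one (hm : m ≤ n) (x : EndCell X.top.toRGSet o h) :
    (x * one o h hm).phi = x.phi := by
  rw [phi_mul, phi_one, EndCell.mul_one]

theorem phi_mul_comm {j : ℕ} {h : j + 1 < m} {hj : j < n} {w : X.top.cell j}
    {o : X.top.cell (j + 1)} (ho : o = X.top.i hj w) (x y : EndCell X.top.toRGSet o h) :
    (x * y).phi = (y * x).phi := by
  rw [phi_mul, phi_mul]
  exact mul_comm_of_eq_i (ho ▸ X.φ.map_i hj w) _ _

end EndCell

namespace CellHom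

section RGSet

variable {n k m : ℕ} {h : k < m} {A : RGSet.{u} n} {o : A.cell k}

/-- A cell between endomorphisms of `o` is itself an endomorphism of `o`. -/
def toEndCell {x y : EndCell A o h} (c : CellHom x.cell y.cell) :
    EndCell A o (h.trans m.lt_succ_self) where
  cell := c.cell
  sTo_cell := by rw [A.sTo_succ h.le, c.s_cell, x.sTo_cell]
  tTo_cell := by rw [A.tTo_succ h.le, c.t_cell, y.tTo_cell]

end RGSet

section Magma

variable {n k m : ℕ} {h : k < m} {M : Magma.{u} n} {o : M.cell k}

/-- Composition along `o` of cells between endomorphisms of `o`. -/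
def mul {x x' y y' : EndCell M.toRGSet o h} (c : CellHom x.cell x'.cell)
    (d : CellHom y.cell y'.cell) : CellHom (x * y).cell (x' * y').cell where
  cell := (c.toEndCell * d.toEndCell).cell
  s_cell := (M.s_comp _ h _ _ _).trans (M.comp_congr _ c.s_cell d.s_cell _)
  t_cell := (M.t_comp _ h _ _ _).trans (M.comp_congr _ c.t_cell d.t_cell _)

end Magma

section QObj

variable {n k m : ℕ} {h : k < m} {X : QObj.{u} n} {o : X.top.cell k}

/-- The image in the base of a cell between endomorphisms. -/
abbrev phi {x y : EndCell X.top.toRGSet o h} (c : CellHom x.cell y.cell) :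
    EndCell X.base.toRGSet (X.φ.app o) (h.trans m.lt_succ_self) :=
  c.toEndCell.phi

variable {x y z x' y' z' : EndCell X.top.toRGSet o h}

theorem phi_mul (c : CellHom x.cell x'.cell) (d : CellHom y.cell y'.cell) :
    (c.mul d).phi = c.phi * d.phi :=
  EndCell.map_mul X.φ rfl c.toEndCell d.toEndCell

theorem phi_mul_assoc (c : CellHom x.cell x'.cell) (d : CellHom y.cell y'.cell)
    (e : CellHom z.cell z'.cell) : ((c.mul d).mul e).phi = (c.mul (d.mul e)).phi := by
  simp only [phi_mul, mul_assoc]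

theorem phi_id_one (hm : m < n) :
    (id hm (EndCell.one o h hm.le : EndCell X.top.toRGSet o h).cell).phi =
      EndCell.one (X.φ.app o) (h.trans m.lt_succ_self) hm := by
  rw [← EndCell.phi_one]
  exact EndCell.ext (congrArg X.φ.app (X.top.iTo_succ h.le _ hm o).symm)

theorem phi_id_one_mul (hm : m < n) (c : CellHom x.cell y.cell) :
    ((id hm (EndCell.one o h hm.le : EndCell X.top.toRGSet o h).cell).mul c).phi = c.phi := by
  rw [phi_mul, phi_id_one, EndCell.one_mul]

theorem phi_mul_id_one (hm : m < n) (c : CellHom x.cell y.cell) :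
    (c.mul (id hm (EndCell.one o h hm.le : EndCell X.top.toRGSet o h).cell)).phi = c.phi := by
  rw [phi_mul, phi_id_one, EndCell.mul_one]

theorem phi_mul_comm {j : ℕ} {h : j + 1 < m} {hj : j < n} {w : X.top.cell j}
    {o : X.top.cell (j + 1)} (ho : o = X.top.i hj w) {x y x' y' : EndCell X.top.toRGSet o h}
    (c : CellHom x.cell x'.cell) (d : CellHom y.cell y'.cell) :
    (c.mul d).phi = (d.mul c).phi :=
  EndCell.phi_mul_comm ho c.toEndCell d.toEndCell

theorem map_mul_comp_mul (c : CellHom x.cell y.cell) (d : CellHom y.cell z.cell)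
    (c' : CellHom x'.cell y'.cell) (d' : CellHom y'.cell z'.cell) :
    X.φ.app ((c.mul c').comp (d.mul d')).cell =
      X.φ.app (mul (x := x) (x' := z) (y := x') (y' := z') (c.comp d) (c'.comp d')).cell := by
  simp only [comp, mul, toEndCell, EndCell.mul_cell, MagmaHom.map_comp]
  exact (X.base.interchange h m.lt_succ_self _ _ _ _ _ _ _).symm

instance (c : CellHom x.cell x'.cell) (d : CellHom y.cell y'.cell) [hc : c.IsCoherent]
    [hd : d.IsCoherent] : (c.mul d).IsCoherent where
  map_cell := by
    refine (X.φ.map_comp _ _ _ _).trans ((X.base.comp_congr _ hc.map_cell hd.map_cell _).trans ?_)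
    refine (X.base.i_comp h _ _ _ (EndCell.composable x.phi y.phi)).symm.trans ?_
    exact congrArg (X.base.i _) (X.φ.map_comp h _ _ _).symm

end QObj

end CellHom

/-- The endomorphisms of `o` of codimension one. They form a category whose morphisms are the cells
of top dimension, and a monoidal one under composition along `o`. -/
abbrev EndoCell {k : ℕ} (X : QObj.{u} (k + 2)) (o : X.top.cell k) : Type u :=
  EndCell X.top.toRGSet o k.lt_succ_self

namespace EndoCell

variable {k : ℕ} {X : QObj.{u} (k + 2)} {o : X.top.cell k}

instance : Category (EndoCell X o) where
  Hom x y := CellHom x.cell y.cell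
  id x := CellHom.id (k + 1).lt_succ_self x.cell
  comp f g := CellHom.comp f g
  id_comp f := CellHom.id_comp f
  comp_id f := CellHom.comp_id f
  assoc f g h := CellHom.assoc f g h

/-- The isomorphism given by the contraction cells `[x, y]` and `[y, x]`. -/
def conIso (x y : EndoCell X o) (h : x.phi = y.phi) : x ≅ y where
  hom := CellHom.con (k + 1).lt_succ_self (x.parallel y) (congrArg EndCell.cell h)
  inv := CellHom.con (k + 1).lt_succ_self (y.parallel x) (congrArg EndCell.cell h.symm)
  hom_inv_id := CellHom.con_comp_con_symm _ _ _
  inv_hom_id := CellHom.con_comp_con_symm _ _ _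

instance : MonoidalCategoryStruct (EndoCell X o) where
  tensorObj x y := x * y
  tensorHom f g := CellHom.mul f g
  whiskerLeft x _ _ g := CellHom.mul (𝟙 x) g
  whiskerRight f y := CellHom.mul f (𝟙 y)
  tensorUnit := EndCell.one o k.lt_succ_self (k + 1).le_succ
  associator x y z := conIso _ _ (EndCell.phi_mul_assoc x y z)
  leftUnitor x := conIso _ _ (EndCell.phi_one_mul _ x)
  rightUnitor x := conIso _ _ (EndCell.phi_mul_one _ x)

theorem tensorObj_eq_mul (x y : EndoCell X o) : x ⊗ y = x * y := rfl

theorem tensorUnit_eq_one : 𝟙_ (EndoCell X o) = EndCell.one o k.lt_succ_self (k + 1).le_succ := rfl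

section IsCoherent

variable {x y z x' y' : EndoCell X o}

instance (x : EndoCell X o) : CellHom.IsCoherent (𝟙 x) :=
  inferInstanceAs (CellHom.id _ _).IsCoherent

instance (f : x ⟶ y) (g : y ⟶ z) [CellHom.IsCoherent f] [CellHom.IsCoherent g] :
    CellHom.IsCoherent (f ≫ g) :=
  inferInstanceAs (CellHom.comp f g).IsCoherent

instance (f : x ⟶ x') (g : y ⟶ y') [CellHom.IsCoherent f] [CellHom.IsCoherent g] :
    CellHom.IsCoherent (f ⊗ₘ g) :=
  inferInstanceAs (CellHom.mul f g).IsCoherent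

instance (x : EndoCell X o) (g : y ⟶ y') [CellHom.IsCoherent g] : CellHom.IsCoherent (x ◁ g) :=
  inferInstanceAs (CellHom.IsCoherent (𝟙 x ⊗ₘ g))

instance (f : x ⟶ x') [CellHom.IsCoherent f] (y : EndoCell X o) : CellHom.IsCoherent (f ▷ y) :=
  inferInstanceAs (CellHom.IsCoherent (f ⊗ₘ 𝟙 y))

instance (h : x.phi = y.phi) : CellHom.IsCoherent (conIso x y h).hom where
  map_cell := X.con.map_cell _ _ _ _ _

instance (h : x.phi = y.phi) : CellHom.IsCoherent (conIso x y h).inv where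
  map_cell := X.con.map_cell _ _ _ _ _

instance : CellHom.IsCoherent (α_ x y z).hom :=
  inferInstanceAs (CellHom.IsCoherent (conIso _ _ (EndCell.phi_mul_assoc x y z)).hom)

instance : CellHom.IsCoherent (α_ x y z).inv :=
  inferInstanceAs (CellHom.IsCoherent (conIso _ _ (EndCell.phi_mul_assoc x y z)).inv)

instance : CellHom.IsCoherent (λ_ x).hom :=
  inferInstanceAs (CellHom.IsCoherent (conIso _ _ (EndCell.phi_one_mul _ x)).hom)

instance : CellHom.IsCoherent (ρ_ x).hom :=
  inferInstanceAs (CellHom.IsCoherent (conIso _ _ (EndCell.phi_mul_one _ x)).hom)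

theorem comp_coherent_eq_coherent_comp {f : x ⟶ y} {e : y ⟶ y'} {e' : x ⟶ x'} {g : x' ⟶ y'}
    [CellHom.IsCoherent e] [CellHom.IsCoherent e'] (h : CellHom.phi f = CellHom.phi g) :
    f ≫ e = e' ≫ g :=
  CellHom.ext_of_map ((CellHom.map_comp_coherent f e).trans
    ((congrArg EndCell.cell h).trans (CellHom.map_coherent_comp e' g).symm))

end IsCoherent

instance : MonoidalCategory (EndoCell X o) :=
  MonoidalCategory.ofTensorHom
    (id_tensorHom_id := fun _ _ => CellHom.IsCoherent.eq _ _)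
    (id_tensorHom := fun _ _ _ _ => rfl)
    (tensorHom_id := fun _ _ => rfl)
    (tensorHom_comp_tensorHom := fun f₁ f₂ g₁ g₂ =>
      CellHom.ext_of_map (CellHom.map_mul_comp_mul f₁ g₁ f₂ g₂))
    (associator_naturality := fun f g h =>
      comp_coherent_eq_coherent_comp (CellHom.phi_mul_assoc f g h))
    (leftUnitor_naturality := fun f =>
      comp_coherent_eq_coherent_comp (CellHom.phi_id_one_mul _ f))
    (rightUnitor_naturality := fun f =>
      comp_coherent_eq_coherent_comp (CellHom.phi_mul_id_one _ f))
    (pentagon := fun _ _ _ _ => CellHom.IsCoherent.eq _ _)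
    (triangle := fun _ _ => CellHom.IsCoherent.eq _ _)

section Symmetric

variable {j : ℕ} {X : QObj.{u} (j + 3)} {o : X.top.cell (j + 1)} {w : X.top.cell j}

/-- The symmetry on the endomorphisms of an identity cell. -/
abbrev symmetricCategory (ho : o = X.top.i (by omega) w) :
    SymmetricCategory (EndoCell (k := j + 1) X o) where
  braiding x y := conIso _ _ (EndCell.phi_mul_comm ho x y)
  braiding_naturality_right x _ _ f :=
    comp_coherent_eq_coherent_comp (CellHom.phi_mul_comm ho (𝟙 x) f)
  braiding_naturality_left f z :=
    comp_coherent_eq_coherent_comp (CellHom.phi_mul_comm ho f (𝟙 z))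
  hexagon_forward _ _ _ := CellHom.IsCoherent.eq _ _
  hexagon_reverse _ _ _ := CellHom.IsCoherent.eq _ _
  symmetry _ _ := CellHom.IsCoherent.eq _ _

end Symmetric

section Functoriality

variable {Y : QObj.{u} (k + 2)} {o' : Y.top.cell k}

theorem map_conIso_hom (F : QHom X Y) {x y : EndoCell X o} {x' y' : EndoCell Y o'}
    (hx : F.top.app x.cell = x'.cell) (hy : F.top.app y.cell = y'.cell) (h : x.phi = y.phi)
    (h' : x'.phi = y'.phi) : F.top.app (conIso x y h).hom.cell = (conIso x' y' h').hom.cell :=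
  (F.map_con _ _ _ _ _).trans (Y.con.cell_congr _ hx hy _ _)

end Functoriality

end EndoCell

/-! ### Evaluation of formal operations in a Penon `n`-category -/

section Algebra

variable {n : ℕ} (A : PenonCat.{u} n)

/-- The free object of `𝒬` on `PA`, whose top magma is `PPA`. -/
noncomputable def freeFree : QObj.{u} n := (freeFunctor n).obj (freeOn A).top.toRGSet

/-- The unit `η : PA → PPA`. -/
noncomputable def freeUnitMap : RGHom (freeOn A).top.toRGSet (freeFree A).top.toRGSet :=
  (freeAdj n).unit.app (freeOn A).top.toRGSet

/-- The multiplication `μ : PPA → PA` of the monad, as a morphism of `𝒬`. -/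
noncomputable def freeMul : QHom (freeFree A) (freeOn A) := (freeAdj n).counit.app (freeOn A)

/-- The map `Pθ : PPA → PA`, as a morphism of `𝒬`. -/
noncomputable def freeAct : QHom (freeFree A) (freeOn A) := (freeFunctor n).map A.a

variable {A}

theorem freeMul_freeUnitMap {k : ℕ} (z : (freeOn A).top.cell k) :
    (freeMul A).top.app ((freeUnitMap A).app z) = z :=
  congrArg (fun f : RGHom (freeOn A).top.toRGSet (freeOn A).top.toRGSet => f.app z)
    ((freeAdj n).right_triangle_components (freeOn A))

theorem freeAct_freeUnitMap {k : ℕ} (z : (freeOn A).top.cell k) :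
    (freeAct A).top.app ((freeUnitMap A).app z) = (unitMap A).app ((actMap A).app z) :=
  (congrArg (fun f : RGHom (freeOn A).top.toRGSet (freeOn A).top.toRGSet => f.app z)
    ((freeAdj n).unit.naturality A.a)).symm

theorem actMap_freeMul {k : ℕ} (z : (freeFree A).top.cell k) :
    (actMap A).app ((freeMul A).top.app z) = (actMap A).app ((freeAct A).top.app z) :=
  congrArg (fun f : RGHom (freeFree A).top.toRGSet A.A => f.app z) A.assoc

end Algebra

theorem EndoCell.actMap_conIso_hom {k : ℕ} {A : PenonCat.{u} (k + 2)} {o : (freeFree A).top.cell k}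
    {o₁ o₂ : (freeOn A).top.cell k} (ho₁ : (freeMul A).top.app o = o₁)
    (ho₂ : (freeAct A).top.app o = o₂) {x y : EndoCell (freeFree A) o} (h : x.phi = y.phi)
    {x₁ y₁ : EndoCell (freeOn A) o₁} (hx₁ : x.map (freeMul A).top.toRGHom ho₁ = x₁)
    (hy₁ : y.map (freeMul A).top.toRGHom ho₁ = y₁) (h₁ : x₁.phi = y₁.phi)
    {x₂ y₂ : EndoCell (freeOn A) o₂} (hx₂ : x.map (freeAct A).top.toRGHom ho₂ = x₂)
    (hy₂ : y.map (freeAct A).top.toRGHom ho₂ = y₂) (h₂ : x₂.phi = y₂.phi) :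
    (actMap A).app (conIso x₁ y₁ h₁).hom.cell = (actMap A).app (conIso x₂ y₂ h₂).hom.cell := by
  rw [← map_conIso_hom (freeMul A) (congrArg EndCell.cell hx₁) (congrArg EndCell.cell hy₁) h,
    actMap_freeMul,
    map_conIso_hom (freeAct A) (congrArg EndCell.cell hx₂) (congrArg EndCell.cell hy₂) h h₂]

/-! ### Formal expressions in a doubly degenerate Penon 3-category -/

section DoublyDegenerate

variable (A : PenonCat.{u} 3) [hA : Fact (IsDoublyDegenerate A.A)]

/-- The identity on the unique 0-cell `*` of `A`, as the 1-cell `i(η(*))` of `PA`. -/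
noncomputable def formalOne : (freeOn A).top.cell 1 :=
  (freeOn A).top.i (k := 0) (by decide) ((unitMap A).app hA.out.zero.some.default)

/-- The formal expressions for 2-cells of `A`: the endomorphisms of `i(η(*))` in `PA`. -/
abbrev FormalCell : Type u := EndoCell (k := 1) (freeOn A) (formalOne A)

noncomputable instance : SymmetricCategory (FormalCell A) := EndoCell.symmetricCategory rfl

variable {A}

theorem unitMap_eq_formalOne (a : A.A.cell 1) : (unitMap A).app a = formalOne A := by
  obtain ⟨_⟩ := hA.out.one
  exact (congrArg _ (Subsingleton.elim _ _)).trans ((unitMap A).map_i (k := 0) (by decide) _)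

/-- A 2-cell of `A` as a formal expression. -/
noncomputable def formalObj (α : TwoCell A) : FormalCell A where
  cell := formal α
  sTo_cell := ((unitMap A).map_sTo _ _).symm.trans (unitMap_eq_formalOne _)
  tTo_cell := ((unitMap A).map_tTo _ _).symm.trans (unitMap_eq_formalOne _)

/-- A 3-cell of `A` as a formal expression. -/
noncomputable def formalHom {α β : TwoCell A} (f : α ⟶ β) : formalObj α ⟶ formalObj β where
  cell := (unitMap A).app f.cell
  s_cell := ((unitMap A).map_s _).symm.trans (congrArg _ f.s_cell)
  t_cell := ((unitMap A).map_t _).symm.trans (congrArg _ f.t_cell)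

/-- The value in `A` of a formal expression for a 2-cell. -/
noncomputable def FormalCell.eval (x : FormalCell A) : TwoCell A := (actMap A).app x.cell

/-- The formal expression in `PPA` consisting of a single variable, which is `x`. -/
noncomputable def FormalCell.nested (x : FormalCell A) :
    EndoCell (k := 1) (freeFree A) ((freeUnitMap A).app (formalOne A)) :=
  x.map (freeUnitMap A) rfl

theorem freeAct_freeUnitMap_formalOne :
    (freeAct A).top.app ((freeUnitMap A).app (formalOne A)) = formalOne A :=
  (freeAct_freeUnitMap _).trans (unitMap_eq_formalOne _)

theorem FormalCell.nested_map_freeMul (x : FormalCell A) :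
    x.nested.map (freeMul A).top.toRGHom (freeMul_freeUnitMap _) = x :=
  EndCell.ext (freeMul_freeUnitMap x.cell)

theorem FormalCell.nested_map_freeAct (x : FormalCell A) :
    x.nested.map (freeAct A).top.toRGHom freeAct_freeUnitMap_formalOne = formalObj x.eval :=
  EndCell.ext (freeAct_freeUnitMap x.cell)

theorem eval_formalObj (α : TwoCell A) : (formalObj α).eval = α := act_unit (k := 2) α

end DoublyDegenerate

/-! ### The symmetric monoidal category of a doubly degenerate Penon 3-category -/

section DoublyDegenerate

variable {A : PenonCat.{u} 3} [hA : Fact (IsDoublyDegenerate A.A)]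
  {α β γ α' β' γ' : TwoCell A} {x y z x' y' : FormalCell A}

/-- The formal 3-cell `c` evaluates to the morphism `f` of `A`. An equation in `A` holds as soon as
its two sides are the values of equal formal 3-cells. -/
def Lifts (c : x ⟶ y) (f : α ⟶ β) : Prop := (actMap A).app c.cell = f.cell

theorem Lifts.eq {c d : x ⟶ y} {f g : α ⟶ β} (hc : Lifts c f) (hd : Lifts d g) (h : c = d) :
    f = g :=
  ThreeCell.ext (hc.symm.trans (h ▸ hd))

theorem lifts_formalHom (f : α ⟶ β) : Lifts (formalHom f) f := act_unit f.cell

theorem lifts_id (hx : x.eval = α) : Lifts (𝟙 x) (𝟙 α) := by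
  subst hx
  exact (actMap A).map_i _ _

theorem Lifts.comp {c : x ⟶ y} {d : y ⟶ z} {f : α ⟶ β} {g : β ⟶ γ} (hc : Lifts c f)
    (hd : Lifts d g) : Lifts (c ≫ d) (f ≫ g) :=
  (act_comp _ _ _ (Magma.composable_top (c.t_cell.trans d.s_cell.symm))).symm.trans
    (compA_congr _ hd hc _)

/-- The value in `A` of a formal 3-cell. -/
noncomputable def evalHom (c : x ⟶ y) (hx : x.eval = α) (hy : y.eval = β) : α ⟶ β where
  cell := (actMap A).app c.cell
  s_cell := ((actMap A).map_s _).symm.trans ((congrArg _ c.s_cell).trans hx)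
  t_cell := ((actMap A).map_t _).symm.trans ((congrArg _ c.t_cell).trans hy)

theorem lifts_evalHom (c : x ⟶ y) (hx : x.eval = α) (hy : y.eval = β) :
    Lifts c (evalHom c hx hy) := rfl

/-- The value in `A` of an isomorphism between formal expressions. -/
noncomputable def evalIso (e : x ≅ y) (hx : x.eval = α) (hy : y.eval = β) : α ≅ β where
  hom := evalHom e.hom hx hy
  inv := evalHom e.inv hy hx
  hom_inv_id := ((lifts_evalHom e.hom hx hy).comp (lifts_evalHom e.inv hy hx)).eq (lifts_id hx)
    e.hom_inv_id
  inv_hom_id := ((lifts_evalHom e.inv hy hx).comp (lifts_evalHom e.hom hx hy)).eq (lifts_id hy)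
    e.inv_hom_id

theorem Lifts.eval_source {c : x ⟶ y} {f : α ⟶ β} (h : Lifts c f) : x.eval = α :=
  (congrArg _ c.s_cell).symm.trans
    (((actMap A).map_s _).trans ((congrArg A.A.s h).trans f.s_cell))

theorem Lifts.eval_target {c : x ⟶ y} {f : α ⟶ β} (h : Lifts c f) : y.eval = β :=
  (congrArg _ c.t_cell).symm.trans
    (((actMap A).map_t _).trans ((congrArg A.A.t h).trans f.t_cell))

theorem Lifts.inv {e : x ≅ y} {i : α ≅ β} (h : Lifts e.hom i.hom) : Lifts e.inv i.inv := by
  have hi : i = evalIso e h.eval_source h.eval_target := Iso.ext (h.eq rfl rfl)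
  rw [hi]
  rfl

/-- The product `α ∘₁ β` of 2-cells. -/
noncomputable def tensorTwoCell (α β : TwoCell A) : TwoCell A :=
  tensorCell hA.out (m := 2) (by decide) α β

theorem eval_tensorObj (hx : x.eval = α) (hy : y.eval = β) :
    (x ⊗ y).eval = tensorTwoCell α β := by
  subst hx hy
  exact (act_comp _ _ _ (EndCell.composable x y)).symm

theorem formalObj_unitCell : formalObj (unitCell hA.out) = 𝟙_ (FormalCell A) := by
  refine EndCell.ext (((unitMap A).map_i _ _).trans ?_)
  rw [unitMap_eq_formalOne]
  exact ((RGSet.iTo_succ _ le_rfl one_le_two _ _).trans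
    (congrArg _ (RGSet.iTo_self _ _ _))).symm

theorem eval_tensorUnit : (𝟙_ (FormalCell A)).eval = unitCell hA.out := by
  rw [← formalObj_unitCell, eval_formalObj]

/-- The product `f ∘₁ g` of 3-cells. -/
noncomputable def tensorThreeCell (f : α ⟶ α') (g : β ⟶ β') :
    tensorTwoCell α β ⟶ tensorTwoCell α' β' :=
  evalHom (formalHom f ⊗ₘ formalHom g) (eval_tensorObj (eval_formalObj α) (eval_formalObj β))
    (eval_tensorObj (eval_formalObj α') (eval_formalObj β'))

noncomputable instance : MonoidalCategoryStruct (TwoCell A) where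
  tensorObj := tensorTwoCell
  tensorHom f g := tensorThreeCell f g
  whiskerLeft α _ _ g := tensorThreeCell (𝟙 α) g
  whiskerRight f β := tensorThreeCell f (𝟙 β)
  tensorUnit := unitCell hA.out
  associator α β γ := evalIso (α_ (formalObj α) (formalObj β) (formalObj γ))
    (eval_tensorObj (eval_tensorObj (eval_formalObj α) (eval_formalObj β)) (eval_formalObj γ))
    (eval_tensorObj (eval_formalObj α) (eval_tensorObj (eval_formalObj β) (eval_formalObj γ)))
  leftUnitor α := evalIso (λ_ (formalObj α)) (eval_tensorObj eval_tensorUnit (eval_formalObj α))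
    (eval_formalObj α)
  rightUnitor α := evalIso (ρ_ (formalObj α)) (eval_tensorObj (eval_formalObj α) eval_tensorUnit)
    (eval_formalObj α)

theorem Lifts.tensor {c : x ⟶ x'} {d : y ⟶ y'} {f : α ⟶ α'} {g : β ⟶ β'} (hc : Lifts c f)
    (hd : Lifts d g) : Lifts (c ⊗ₘ d) (f ⊗ₘ g) :=
  (act_comp _ _ _ (EndCell.composable c.toEndCell d.toEndCell)).symm.trans (compA_congr _ hc hd _)

theorem Lifts.whiskerLeft (hx : x.eval = α) {d : y ⟶ y'} {g : β ⟶ β'} (hd : Lifts d g) :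
    Lifts (x ◁ d) (α ◁ g) :=
  (lifts_id hx).tensor hd

theorem Lifts.whiskerRight {c : x ⟶ x'} {f : α ⟶ α'} (hc : Lifts c f) (hy : y.eval = β) :
    Lifts (c ▷ y) (f ▷ β) :=
  hc.tensor (lifts_id hy)

theorem lifts_associator (hx : x.eval = α) (hy : y.eval = β) (hz : z.eval = γ) :
    Lifts (α_ x y z).hom (α_ α β γ).hom := by
  subst hx hy hz
  refine EndoCell.actMap_conIso_hom (freeMul_freeUnitMap _) freeAct_freeUnitMap_formalOne
    (EndCell.phi_mul_assoc x.nested y.nested z.nested) ?_ ?_ _ ?_ ?_ _ <;>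
  simp only [EndCell.map_mul, EndoCell.tensorObj_eq_mul, FormalCell.nested_map_freeMul,
    FormalCell.nested_map_freeAct]

theorem lifts_leftUnitor (hx : x.eval = α) : Lifts (λ_ x).hom (λ_ α).hom := by
  subst hx
  refine EndoCell.actMap_conIso_hom (freeMul_freeUnitMap _) freeAct_freeUnitMap_formalOne
    (EndCell.phi_one_mul (by decide) x.nested) ?_ ?_ _ ?_ ?_ _ <;>
  simp only [EndCell.map_mul, EndCell.map_one, EndoCell.tensorObj_eq_mul,
    EndoCell.tensorUnit_eq_one, FormalCell.nested_map_freeMul, FormalCell.nested_map_freeAct]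

theorem lifts_rightUnitor (hx : x.eval = α) : Lifts (ρ_ x).hom (ρ_ α).hom := by
  subst hx
  refine EndoCell.actMap_conIso_hom (freeMul_freeUnitMap _) freeAct_freeUnitMap_formalOne
    (EndCell.phi_mul_one (by decide) x.nested) ?_ ?_ _ ?_ ?_ _ <;>
  simp only [EndCell.map_mul, EndCell.map_one, EndoCell.tensorObj_eq_mul,
    EndoCell.tensorUnit_eq_one, FormalCell.nested_map_freeMul, FormalCell.nested_map_freeAct]

/-- The braiding of `A`, the value of the braiding of formal expressions. -/
noncomputable def braidingIso (α β : TwoCell A) : α ⊗ β ≅ β ⊗ α :=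
  evalIso (β_ (formalObj α) (formalObj β))
    (eval_tensorObj (eval_formalObj α) (eval_formalObj β))
    (eval_tensorObj (eval_formalObj β) (eval_formalObj α))

theorem lifts_braidingIso (hx : x.eval = α) (hy : y.eval = β) :
    Lifts (β_ x y).hom (braidingIso α β).hom := by
  subst hx hy
  have h : (x.nested * y.nested).phi = (y.nested * x.nested).phi :=
    EndCell.phi_mul_comm ((freeUnitMap A).map_i _ _) x.nested y.nested
  refine EndoCell.actMap_conIso_hom (freeMul_freeUnitMap _) freeAct_freeUnitMap_formalOne h
    ?_ ?_ _ ?_ ?_ _ <;>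
  simp only [EndCell.map_mul, EndoCell.tensorObj_eq_mul, FormalCell.nested_map_freeMul,
    FormalCell.nested_map_freeAct]

namespace TwoCell

theorem id_tensorHom_id (α β : TwoCell A) : 𝟙 α ⊗ₘ 𝟙 β = 𝟙 (α ⊗ β) := by
  have ha := eval_formalObj α
  have hb := eval_formalObj β
  exact ((lifts_id ha).tensor (lifts_id hb)).eq (lifts_id (eval_tensorObj ha hb))
    (MonoidalCategory.id_tensorHom_id _ _)

theorem tensorHom_comp_tensorHom (f₁ : α ⟶ β) (f₂ : α' ⟶ β') (g₁ : β ⟶ γ) (g₂ : β' ⟶ γ') :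
    (f₁ ⊗ₘ f₂) ≫ (g₁ ⊗ₘ g₂) = (f₁ ≫ g₁) ⊗ₘ (f₂ ≫ g₂) := by
  have hf₁ := lifts_formalHom f₁
  have hf₂ := lifts_formalHom f₂
  have hg₁ := lifts_formalHom g₁
  have hg₂ := lifts_formalHom g₂
  exact ((hf₁.tensor hf₂).comp (hg₁.tensor hg₂)).eq ((hf₁.comp hg₁).tensor (hf₂.comp hg₂))
    (MonoidalCategory.tensorHom_comp_tensorHom _ _ _ _)

theorem associator_naturality (f : α ⟶ α') (g : β ⟶ β') (h : γ ⟶ γ') :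
    ((f ⊗ₘ g) ⊗ₘ h) ≫ (α_ α' β' γ').hom = (α_ α β γ).hom ≫ (f ⊗ₘ (g ⊗ₘ h)) := by
  have hf := lifts_formalHom f
  have hg := lifts_formalHom g
  have hh := lifts_formalHom h
  have hs := lifts_associator hf.eval_source hg.eval_source hh.eval_source
  have ht := lifts_associator hf.eval_target hg.eval_target hh.eval_target
  exact (((hf.tensor hg).tensor hh).comp ht).eq (hs.comp (hf.tensor (hg.tensor hh)))
    (MonoidalCategory.associator_naturality _ _ _)

theorem leftUnitor_naturality (f : α ⟶ β) : 𝟙_ _ ◁ f ≫ (λ_ β).hom = (λ_ α).hom ≫ f := by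
  have hf := lifts_formalHom f
  exact ((hf.whiskerLeft eval_tensorUnit).comp (lifts_leftUnitor hf.eval_target)).eq
    ((lifts_leftUnitor hf.eval_source).comp hf) (MonoidalCategory.leftUnitor_naturality _)

theorem rightUnitor_naturality (f : α ⟶ β) : f ▷ 𝟙_ _ ≫ (ρ_ β).hom = (ρ_ α).hom ≫ f := by
  have hf := lifts_formalHom f
  exact ((hf.whiskerRight eval_tensorUnit).comp (lifts_rightUnitor hf.eval_target)).eq
    ((lifts_rightUnitor hf.eval_source).comp hf) (MonoidalCategory.rightUnitor_naturality _)

theorem pentagon (α β γ δ : TwoCell A) :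
    (α_ α β γ).hom ▷ δ ≫ (α_ α (β ⊗ γ) δ).hom ≫ α ◁ (α_ β γ δ).hom =
      (α_ (α ⊗ β) γ δ).hom ≫ (α_ α β (γ ⊗ δ)).hom := by
  have ha := eval_formalObj α
  have hb := eval_formalObj β
  have hc := eval_formalObj γ
  have hd := eval_formalObj δ
  exact (((lifts_associator ha hb hc).whiskerRight hd).comp
    ((lifts_associator ha (eval_tensorObj hb hc) hd).comp
      ((lifts_associator hb hc hd).whiskerLeft ha))).eq
    ((lifts_associator (eval_tensorObj ha hb) hc hd).comp
      (lifts_associator ha hb (eval_tensorObj hc hd))) (MonoidalCategory.pentagon _ _ _ _)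

theorem triangle (α β : TwoCell A) : (α_ α (𝟙_ _) β).hom ≫ α ◁ (λ_ β).hom = (ρ_ α).hom ▷ β := by
  have ha := eval_formalObj α
  have hb := eval_formalObj β
  exact ((lifts_associator ha eval_tensorUnit hb).comp ((lifts_leftUnitor hb).whiskerLeft ha)).eq
    ((lifts_rightUnitor ha).whiskerRight hb) (MonoidalCategory.triangle _ _)

end TwoCell

noncomputable instance : MonoidalCategory (TwoCell A) :=
  MonoidalCategory.ofTensorHom
    (id_tensorHom_id := TwoCell.id_tensorHom_id)
    (id_tensorHom := fun _ _ _ _ => rfl)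
    (tensorHom_id := fun _ _ => rfl)
    (tensorHom_comp_tensorHom := TwoCell.tensorHom_comp_tensorHom)
    (associator_naturality := TwoCell.associator_naturality)
    (leftUnitor_naturality := TwoCell.leftUnitor_naturality)
    (rightUnitor_naturality := TwoCell.rightUnitor_naturality)
    (pentagon := TwoCell.pentagon)
    (triangle := TwoCell.triangle)

namespace TwoCell

theorem braiding_naturality_right (α : TwoCell A) (g : β ⟶ β') :
    α ◁ g ≫ (braidingIso α β').hom = (braidingIso α β).hom ≫ g ▷ α := by
  have ha := eval_formalObj α
  have hg := lifts_formalHom g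
  exact ((hg.whiskerLeft ha).comp (lifts_braidingIso ha hg.eval_target)).eq
    ((lifts_braidingIso ha hg.eval_source).comp (hg.whiskerRight ha))
    (BraidedCategory.braiding_naturality_right _ _)

theorem braiding_naturality_left (f : α ⟶ α') (β : TwoCell A) :
    f ▷ β ≫ (braidingIso α' β).hom = (braidingIso α β).hom ≫ β ◁ f := by
  have hf := lifts_formalHom f
  have hb := eval_formalObj β
  exact ((hf.whiskerRight hb).comp (lifts_braidingIso hf.eval_target hb)).eq
    ((lifts_braidingIso hf.eval_source hb).comp (hf.whiskerLeft hb))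
    (BraidedCategory.braiding_naturality_left _ _)

theorem hexagon_forward (α β γ : TwoCell A) :
    (α_ α β γ).hom ≫ (braidingIso α (β ⊗ γ)).hom ≫ (α_ β γ α).hom =
      (braidingIso α β).hom ▷ γ ≫ (α_ β α γ).hom ≫ β ◁ (braidingIso α γ).hom := by
  have ha := eval_formalObj α
  have hb := eval_formalObj β
  have hc := eval_formalObj γ
  exact ((lifts_associator ha hb hc).comp
    ((lifts_braidingIso ha (eval_tensorObj hb hc)).comp (lifts_associator hb hc ha))).eq
    (((lifts_braidingIso ha hb).whiskerRight hc).comp ((lifts_associator hb ha hc).comp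
      ((lifts_braidingIso ha hc).whiskerLeft hb))) (BraidedCategory.hexagon_forward _ _ _)

theorem hexagon_reverse (α β γ : TwoCell A) :
    (α_ α β γ).inv ≫ (braidingIso (α ⊗ β) γ).hom ≫ (α_ γ α β).inv =
      α ◁ (braidingIso β γ).hom ≫ (α_ α γ β).inv ≫ (braidingIso α γ).hom ▷ β := by
  have ha := eval_formalObj α
  have hb := eval_formalObj β
  have hc := eval_formalObj γ
  exact ((lifts_associator ha hb hc).inv.comp
    ((lifts_braidingIso (eval_tensorObj ha hb) hc).comp (lifts_associator hc ha hb).inv)).eq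
    (((lifts_braidingIso hb hc).whiskerLeft ha).comp ((lifts_associator ha hc hb).inv.comp
      ((lifts_braidingIso ha hc).whiskerRight hb))) (BraidedCategory.hexagon_reverse _ _ _)

theorem symmetry (α β : TwoCell A) :
    (braidingIso α β).hom ≫ (braidingIso β α).hom = 𝟙 (α ⊗ β) := by
  have ha := eval_formalObj α
  have hb := eval_formalObj β
  exact ((lifts_braidingIso ha hb).comp (lifts_braidingIso hb ha)).eq
    (lifts_id (eval_tensorObj ha hb)) (SymmetricCategory.symmetry _ _)

end TwoCell

noncomputable instance : SymmetricCategory (TwoCell A) where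
  braiding := braidingIso
  braiding_naturality_right α _ _ g := TwoCell.braiding_naturality_right α g
  braiding_naturality_left f β := TwoCell.braiding_naturality_left f β
  hexagon_forward := TwoCell.hexagon_forward
  hexagon_reverse := TwoCell.hexagon_reverse
  symmetry := TwoCell.symmetry

theorem isContractionValue_conIso_hom (h : x.phi = y.phi) :
    IsContractionValue x.cell y.cell ((actMap A).app (EndoCell.conIso x y h).hom.cell) :=
  ⟨x.parallel y, congrArg EndCell.cell h, rfl⟩

theorem isContractionValue_leftUnitor (α : TwoCell A) :
    IsContractionValue (formalTwo hA.out (unitCell hA.out) α) (formal α) (λ_ α).hom.cell := by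
  have h : (𝟙_ (FormalCell A) ⊗ formalObj α).cell = formalTwo hA.out (unitCell hA.out) α := by
    rw [← formalObj_unitCell]
    rfl
  rw [← h]
  exact isContractionValue_conIso_hom (EndCell.phi_one_mul _ (formalObj α))

theorem isContractionValue_rightUnitor (α : TwoCell A) :
    IsContractionValue (formalTwo hA.out α (unitCell hA.out)) (formal α) (ρ_ α).hom.cell := by
  have h : (formalObj α ⊗ 𝟙_ (FormalCell A)).cell = formalTwo hA.out α (unitCell hA.out) := by
    rw [← formalObj_unitCell]
    rfl
  rw [← h]
  exact isContractionValue_conIso_hom (EndCell.phi_mul_one _ (formalObj α))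

end DoublyDegenerate

end Penon

theorem mainTheorem1 (A : PenonCat.{u} 3) (hA : IsDoublyDegenerate A.A) :
    -- the base of the free object on `A` is the free strict 3-category `T_R A`
    IsFreeStrictCat A.A (freeOn A).base ((unitMap A).comp (freeOn A).φ.toRGHom) ∧
    -- `α ∘ β = β ∘ α` in `T_R A`, so that the contraction cell `[α ∘ β, β ∘ α]` exists
    (∀ α β : TwoCell A, (freeOn A).φ.app (formalTwo hA α β) =
      (freeOn A).φ.app (formalTwo hA β α)) ∧
    -- `[x, y] ∘ [y, x] = 1` for every contraction 3-cell `[x, y]` of `PA`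
    (∀ (x y : (freeOn A).top.cell 2) (hp : RGSet.Parallel x y)
      (hφ : (freeOn A).φ.app x = (freeOn A).φ.app y) (hp' : RGSet.Parallel y x)
      (hφ' : (freeOn A).φ.app y = (freeOn A).φ.app x),
      (freeOn A).top.comp 2 (by decide) ((freeOn A).con.cell (by decide) x y hp hφ)
          ((freeOn A).con.cell (by decide) y x hp' hφ')
          (composable_con (freeOn A) (by decide) hp hφ hp' hφ') =
        (freeOn A).top.i (by decide) y) ∧
    -- the 2-cells and 3-cells of `A` form a symmetric monoidal category, with the stated data
    ∃ (_ : MonoidalCategory (TwoCell A)) (_ : SymmetricCategory (TwoCell A)),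
      (∀ α β : TwoCell A, α ⊗ β = tensorCell hA (m := 2) (by decide) α β) ∧
      (∀ (α α' β β' : TwoCell A) (f : α ⟶ α') (g : β ⟶ β'),
        (f ⊗ₘ g).cell = tensorCell hA (by decide) f.cell g.cell) ∧
      𝟙_ (TwoCell A) = unitCell hA ∧
      (∀ α β γ : TwoCell A, IsContractionValue (formalLeft hA α β γ) (formalRight hA α β γ)
        (α_ α β γ).hom.cell) ∧
      (∀ α : TwoCell A, IsContractionValue (formalTwo hA (unitCell hA) α) (formal α)
        (λ_ α).hom.cell) ∧
      (∀ α : TwoCell A, IsContractionValue (formalTwo hA α (unitCell hA)) (formal α)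
        (ρ_ α).hom.cell) ∧
      (∀ α β : TwoCell A, IsContractionValue (formalTwo hA α β) (formalTwo hA β α)
        ((β_ α β).hom : α ⊗ β ⟶ β ⊗ α).cell) := by
  have : Fact (IsDoublyDegenerate A.A) := ⟨hA⟩
  refine ⟨isFreeStrictCat_of_adjunction (freeAdj 3) A.A,
    fun α β => congrArg EndCell.cell
      (EndCell.phi_mul_comm rfl (formalObj α) (formalObj β)),
    fun _ _ hp _ hp' hφ' => congrArg CellHom.cell (CellHom.con_comp_con_symm hp' hφ' hp),
    inferInstance, inferInstance, fun _ _ => rfl, fun _ _ _ _ _ _ => rfl, rfl,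
    fun α β γ => isContractionValue_conIso_hom
      (EndCell.phi_mul_assoc (formalObj α) (formalObj β) (formalObj γ)),
    isContractionValue_leftUnitor, isContractionValue_rightUnitor,
    fun α β => isContractionValue_conIso_hom
      (EndCell.phi_mul_comm rfl (formalObj α) (formalObj β))⟩
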